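/- Let $d\ge 3$ be an integer, $0<\alpha<1$, and let $(C_V,\kappa,R,\mu_0,\lambda_0)\in(0,\infty)^5$ satisfy $C_V\le \frac{\kappa}{2\mu_0+\lambda_0}$. Consider real functions $P\in C^1(0,\infty)$, $U,\Theta\in C^2(0,\infty)$ that solve, for all $r>0$, the profile system for radially symmetric backward self-similar solutions (shrinkers) $\rho=P\big(\tfrac{|x|}{\sqrt{T-t}}\big)$, $u=\tfrac{1}{\sqrt{T-t}}U\big(\tfrac{|x|}{\sqrt{T-t}}\big)\tfrac{x}{|x|}$, $\theta=\tfrac1{T-t}\Theta\big(\tfrac{|x|}{\sqrt{T-t}}\big)$ of the compressible Navier--Stokes--Fourier system in $\mathbb R^d$ with pressure $R\rho\theta$, internal energy $C_V\theta$, heat conductivity $\kappa$ and viscosities $\mu=\mu_0\rho^\alpha$, $\lambda=\lambda_0\rho^\alpha$. With $D:=U'+\frac{d-1}{r}U$, $E:=\frac{U^2}{2}+C_V\Theta$ and $\Delta_1U:=U''+\frac{d-1}{r}U'-\frac{d-1}{r^2}U$, this system reads $$\tfrac12 rP'+P'U+PD=0,$$ $$\tfrac12PU+\tfrac12r(PU)'+(PU^2)'+\tfrac{d-1}{r}PU^2+(PR\Theta)'=(2\mu_0+\lambda_0)P^\alpha\Delta_1U-(2\mu_0+\lambda_0)\alpha\frac{D}{\frac12r+U}P^\alpha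 U'-\lambda_0\alpha\frac{D}{\frac12r+U}P^\alpha\frac{d-1}{r}U,$$ $$PE+\tfrac12r(PE)'+(UPE+UPR\Theta)'+\tfrac{d-1}{r}(UPE+UPR\Theta)-\kappa\Big(\Theta''+\tfrac{d-1}{r}\Theta'\Big)$$ $$=2\mu_0P^\alpha\Big((U')^2+\tfrac{d-1}{r^2}U^2\Big)+\lambda_0P^\alpha D^2+(2\mu_0+\lambda_0)P^\alpha(\Delta_1U)\,U-(2\mu_0+\lambda_0)\alpha\frac{D}{\frac12r+U}P^\alpha U'U-\lambda_0\alpha\frac{D}{\frac12r+U}P^\alpha\frac{d-1}{r}U^2.$$ Say that $P$ satisfies the cavitation conditions with constants $\varepsilon,P_\varepsilon,\Lambda>0$ if $P(r)\ge P_\varepsilon$ for all $r\ge\varepsilon$, and if for all $r\in(0,\varepsilon)$ one has $P(r)>0$, $$\frac{r\int_0^rP^{1-\alpha}(s)\,ds}{\int_0^rP^{1-\alpha}(s)\,s\,ds}\le\Lambda\qquad\text{and}\qquad\frac{\int_0^rP(s)\,ds}{P(r)^\alpha\int_0^rP^{1-\alpha}(s)\,ds}\le\Lambda .$$ Let $\varepsilon,\Lambda>0$.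 Then there is $C_1>0$ (depending only on $d,\alpha,C_V,\kappa,R,\mu_0,\lambda_0,\varepsilon,\Lambda$) such that for every $P_\varepsilon>0$ there is $C_2>0$ (depending only on the same data and on $P_\varepsilon$) with the following property. If $(P,U,\Theta)$ is a solution of the profile system such that $P$ satisfies the cavitation conditions with constants $\varepsilon,P_\varepsilon,\Lambda$ and $$\sup_{r>0}P^{1-\alpha}<C_1,\qquad \sup_{r>0}\Big(\langle r\rangle^2|\Theta|+\Big|\frac{U}{r\Theta}\Big|\Big)+\sup_{r>\varepsilon}\Big|\frac{U'}{r\Theta'}\Big|<C_2,$$ where $\langle r\rangle^2=1+r^2$ and where a quotient $a/0$ is read as $+\infty$ if $a\ne0$ and as $0$ if $a=0$, then $U\equiv\Theta\equiv0$ and $P$ is constant on $(0,\infty)$. In particular, with $C=\min(C_1,C_2)$, the single condition $\sup_{r>0}\big(\langle r\rangle^2|\Theta|+P^{1-\alpha}+|\frac{U}{r\Theta}|\big)+\sup_{r>\varepsilon}|\frac{U'}{r\Theta'}|<C$ implies $U\equiv\Theta\equiv0$ and $P$ constant. -/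

import Mathlib

open scoped ENNReal

noncomputable section

namespace CNSShrinker

/-- The system of ordinary differential equations, on `r > 0`, for the profiles `(P, U, Θ)` of a
radially symmetric backward self-similar solution
`ρ = P(|x|/√(T-t))`, `u = (T-t)^(-1/2) U(|x|/√(T-t)) x/|x|`, `θ = (T-t)⁻¹ Θ(|x|/√(T-t))`
of the full compressible Navier-Stokes system on `ℝ^d` with viscosities
`μ(ρ) = μ₀ ρ^α`, `λ(ρ) = lam₀ ρ^α`.
The solutions are classical on `r > 0`; only the values of the profiles there matter. -/
structure IsShrinkerProfile (d : ℕ) (α CV κ R μ₀ lam₀ : ℝ) (P U Θ : ℝ → ℝ) : Prop where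
  contDiffOn_P : ContDiffOn ℝ 1 P (Set.Ioi 0)
  contDiffOn_U : ContDiffOn ℝ 2 U (Set.Ioi 0)
  contDiffOn_Θ : ContDiffOn ℝ 2 Θ (Set.Ioi 0)
  /-- conservation of mass -/
  mass : ∀ r : ℝ, 0 < r →
    1 / 2 * r * deriv P r + deriv P r * U r
      + P r * (deriv U r + (d - 1) / r * U r) = 0
  /-- conservation of momentum -/
  momentum : ∀ r : ℝ, 0 < r →
    1 / 2 * P r * U r + 1 / 2 * r * deriv (fun s => P s * U s) r
      + deriv (fun s => P s * U s ^ 2) r + (d - 1) / r * P r * U r ^ 2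
      + deriv (fun s => P s * R * Θ s) r
    = (2 * μ₀ + lam₀) * P r ^ α
        * (deriv (deriv U) r + (d - 1) / r * deriv U r - (d - 1) / r ^ 2 * U r)
      - (2 * μ₀ + lam₀) * α * ((deriv U r + (d - 1) / r * U r) / (1 / 2 * r + U r))
        * P r ^ α * deriv U r
      - lam₀ * α * ((deriv U r + (d - 1) / r * U r) / (1 / 2 * r + U r))
        * P r ^ α * ((d - 1) / r) * U r
  /-- conservation of energy -/
  energy : ∀ r : ℝ, 0 < r →
    P r * (U r ^ 2 / 2 + CV * Θ r)
      + 1 / 2 * r * deriv (fun s => P s * (U s ^ 2 / 2 + CV * Θ s)) r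
      + deriv (fun s => U s * P s * (U s ^ 2 / 2 + CV * Θ s) + U s * P s * R * Θ s) r
      + (d - 1) / r * (U r * P r * (U r ^ 2 / 2 + CV * Θ r) + U r * P r * R * Θ r)
      - κ * (deriv (deriv Θ) r + (d - 1) / r * deriv Θ r)
    = 2 * μ₀ * P r ^ α * (deriv U r ^ 2 + (d - 1) / r ^ 2 * U r ^ 2)
      + lam₀ * P r ^ α * (deriv U r + (d - 1) / r * U r) ^ 2
      + (2 * μ₀ + lam₀) * P r ^ α
        * (deriv (deriv U) r + (d - 1) / r * deriv U r - (d - 1) / r ^ 2 * U r) * U r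
      - (2 * μ₀ + lam₀) * α * ((deriv U r + (d - 1) / r * U r) / (1 / 2 * r + U r))
        * P r ^ α * deriv U r * U r
      - lam₀ * α * ((deriv U r + (d - 1) / r * U r) / (1 / 2 * r + U r))
        * P r ^ α * ((d - 1) / r) * U r ^ 2

/-- The cavitation conditions on the density profile: `P ≥ Pε` for `r ≥ ε`, and the two quotient
bounds by `Λ` on `(0, ε)`.  The density is positive on `(0, ε)`, so that no denominator vanishes
for a bounded density. -/
structure Cavitates (α ε Pε Λ : ℝ) (P : ℝ → ℝ) : Prop where
  lower_bound : ∀ r : ℝ, ε ≤ r → Pε ≤ P r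
  pos : ∀ r : ℝ, 0 < r → r < ε → 0 < P r
  moment_ratio : ∀ r : ℝ, 0 < r → r < ε →
    (r * ∫ s in (0 : ℝ)..r, P s ^ (1 - α)) / (∫ s in (0 : ℝ)..r, P s ^ (1 - α) * s) ≤ Λ
  mass_ratio : ∀ r : ℝ, 0 < r → r < ε →
    (∫ s in (0 : ℝ)..r, P s) / (P r ^ α * ∫ s in (0 : ℝ)..r, P s ^ (1 - α)) ≤ Λ

/-- `sup_{r > 0} P^{1-α}`, as an extended nonnegative number. -/
def densitySize (α : ℝ) (P : ℝ → ℝ) : ℝ≥0∞ :=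
  ⨆ r : Set.Ioi (0 : ℝ), ENNReal.ofReal (P r ^ (1 - α))

/-- `sup_{r > 0} (⟨r⟩² |Θ| + |U / (r Θ)|) + sup_{r > ε} |U' / (r Θ')|`, where `⟨r⟩² = 1 + r²`, as an
extended nonnegative number.  The quotients are taken in `[0, ∞]`: there `a / 0 = ∞` for `a ≠ 0`
and `0 / 0 = 0`, so that `|U / (r Θ)| ≤ M` means `|U| ≤ M r |Θ|`. -/
def profileSize (ε : ℝ) (U Θ : ℝ → ℝ) : ℝ≥0∞ :=
  (⨆ r : Set.Ioi (0 : ℝ),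
      (ENNReal.ofReal ((1 + (r : ℝ) ^ 2) * |Θ r|)
        + ENNReal.ofReal |U r| / ENNReal.ofReal |(r : ℝ) * Θ r|))
    + ⨆ r : Set.Ioi ε, ENNReal.ofReal |deriv U r| / ENNReal.ofReal |(r : ℝ) * deriv Θ r|

end CNSShrinker

end

/-! ### Pointwise form of the smallness hypotheses -/

noncomputable section

namespace CNSShrinker

/-! Write `n = d - 1` and let `M = sup |Θ|`; suppose `M > 0`. The decay of `Θ` excludes the supremum
at infinity. At a maximum of `|Θ|` beyond `ε`, `Θ' = 0` forces `U' = 0`, and the internal energy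
equation, with `P ≥ Pε` and `U` small relative to `Θ`, gives `Θ''` the sign of `Θ`, a contradiction
(`not_isMax`).

What remains is the ball of radius `ε`, where `P` may degenerate and no regularity at `0` is given.
There the conservation laws are used in flux form: the mass flux has derivative `(n+1)/2 · rⁿP` and
the energy flux has derivative `-(n-1)/2 · rⁿPE`. If `E` is within `e` of a constant `c`, then
energy flux plus `(n-1)/(n+1) · c` times mass flux is monotone up to `e` times mass flux. The
constant of integration at `0` vanishes, because a nonzero flux would make a bounded potential
diverge at least logarithmically (`nonpos_of_antitone_flux`). This yields the heat flux without
dividing by `P` (`heatFlux_estimate`).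

Taking `c = 0` and a small density shows that `Θ` is nearly constant on `(0, 2ε]`
(`oscillation_le`). If `|Θ|` were close to `M` somewhere in `(0, ε]`, then taking `c = ± CV M` shows
that the heat flux has the sign of `Θ`, with a definite size on `[ε, 2ε]`, so `|Θ|` would exceed `M`
at `2ε` (`abs_temperature_le_near_zero`). Hence `M = 0`; then `U = 0`, and the mass equation makes
`P` constant. -/

theorem rpow_lt_of_densitySize_lt {α C : ℝ} {P : ℝ → ℝ}
    (h : densitySize α P < ENNReal.ofReal C) {r : ℝ} (hr : 0 < r) : P r ^ (1 - α) < C := by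
  have h1 : ENNReal.ofReal (P r ^ (1 - α)) < ENNReal.ofReal C :=
    lt_of_le_of_lt (le_iSup (fun r : Set.Ioi (0 : ℝ) => ENNReal.ofReal (P r ^ (1 - α))) ⟨r, hr⟩) h
  exact (ENNReal.ofReal_lt_ofReal_iff'.1 h1).1

theorem abs_le_mul_of_ofReal_div_le {a b C : ℝ} (hC : 0 ≤ C)
    (h : ENNReal.ofReal |a| / ENNReal.ofReal |b| ≤ ENNReal.ofReal C) : |a| ≤ C * |b| := by
  by_cases hb : b = 0
  · subst hb
    by_cases ha : a = 0
    · simp [ha]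
    · exfalso
      rw [abs_zero, ENNReal.ofReal_zero, ENNReal.div_zero] at h
      · exact absurd h (by simp)
      · simpa using ha
  · have hb' : ENNReal.ofReal |b| ≠ 0 := by simpa using hb
    rw [ENNReal.div_le_iff hb' ENNReal.ofReal_ne_top, ← ENNReal.ofReal_mul hC] at h
    exact (ENNReal.ofReal_le_ofReal_iff (by positivity)).1 h

theorem bounds_of_profileSize_lt {ε C : ℝ} {U Θ : ℝ → ℝ} (hC : 0 ≤ C)
    (h : profileSize ε U Θ < ENNReal.ofReal C) :
    (∀ r, 0 < r → (1 + r ^ 2) * |Θ r| ≤ C) ∧ (∀ r, 0 < r → |U r| ≤ C * |r * Θ r|) ∧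
      ∀ r, ε < r → |deriv U r| ≤ C * |r * deriv Θ r| := by
  have h1 : ∀ r, 0 < r → ENNReal.ofReal ((1 + r ^ 2) * |Θ r|)
        + ENNReal.ofReal |U r| / ENNReal.ofReal |r * Θ r| ≤ ENNReal.ofReal C := fun r hr =>
    ((le_iSup (fun r : Set.Ioi (0 : ℝ) => (ENNReal.ofReal ((1 + (r : ℝ) ^ 2) * |Θ r|)
        + ENNReal.ofReal |U r| / ENNReal.ofReal |(r : ℝ) * Θ r|)) ⟨r, hr⟩).trans
      le_self_add).trans h.le
  refine ⟨fun r hr => ?_, fun r hr => ?_, fun r hr => ?_⟩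
  · exact (ENNReal.ofReal_le_ofReal_iff hC).1 (le_self_add.trans (h1 r hr))
  · exact abs_le_mul_of_ofReal_div_le hC (le_add_self.trans (h1 r hr))
  · exact abs_le_mul_of_ofReal_div_le hC
      (((le_iSup (fun r : Set.Ioi ε =>
        ENNReal.ofReal |deriv U r| / ENNReal.ofReal |(r : ℝ) * deriv Θ r|) ⟨r, hr⟩).trans
      le_add_self).trans h.le)

/-! ### Calculus on the half-line and vanishing of fluxes at the origin -/

theorem hasDerivAt_of_contDiffOn_Ioi {f : ℝ → ℝ} (hf : ContDiffOn ℝ 1 f (Set.Ioi 0)) {r : ℝ}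
    (hr : 0 < r) : HasDerivAt f (deriv f r) r :=
  ((hf.differentiableOn (by norm_num)).differentiableAt (Ioi_mem_nhds hr)).hasDerivAt

theorem hasDerivAt_deriv_of_contDiffOn_Ioi {f : ℝ → ℝ} (hf : ContDiffOn ℝ 2 f (Set.Ioi 0)) {r : ℝ}
    (hr : 0 < r) : HasDerivAt (deriv f) (deriv (deriv f) r) r := by
  have h2 : ContDiffOn ℝ ((1 : ℕ∞) + 1 : WithTop ℕ∞) f (Set.Ioi 0) := by
    convert hf using 1; norm_num
  exact hasDerivAt_of_contDiffOn_Ioi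
    ((contDiffOn_succ_iff_deriv_of_isOpen isOpen_Ioi).1 h2).2.2 hr

/-- A nonincreasing quantity `f` that drives a bounded function `S` at the rate `r⁻ⁿ f`, up to a
bounded error, cannot be positive: otherwise `S` would diverge at least logarithmically at `0`. -/
theorem nonpos_of_antitone_flux {f f' S S' : ℝ → ℝ} {L B B₂ : ℝ} {n : ℕ} (hn : 1 ≤ n)
    (hf : ∀ r, 0 < r → r ≤ L → HasDerivAt f (f' r) r) (hf' : ∀ r, 0 < r → r ≤ L → f' r ≤ 0)
    (hS : ∀ r, 0 < r → r ≤ L → HasDerivAt S (S' r) r)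
    (hfS : ∀ r, 0 < r → r ≤ L → f r ≤ r ^ n * (S' r + B))
    (hSB : ∀ r, 0 < r → r ≤ L → |S r| ≤ B₂) {r : ℝ} (hr : 0 < r) (hrL : r ≤ L) : f r ≤ 0 := by
  by_contra! ha
  have hanti : ∀ s, 0 < s → s ≤ r → f r ≤ f s := by
    intro s hs hsr
    have : AntitoneOn f (Set.Icc s r) := by
      refine antitoneOn_of_hasDerivWithinAt_nonpos (f' := f') (convex_Icc s r)
        (fun x hx => (hf x (hs.trans_le hx.1) (hx.2.trans hrL)).continuousAt.continuousWithinAt)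
        (fun x hx => ?_) (fun x hx => ?_)
      · rw [interior_Icc] at hx
        exact (hf x (hs.trans hx.1) (hx.2.le.trans hrL)).hasDerivWithinAt
      · rw [interior_Icc] at hx
        exact hf' x (hs.trans hx.1) (hx.2.le.trans hrL)
    exact this (Set.left_mem_Icc.2 hsr) (Set.right_mem_Icc.2 hsr) hsr
  set a := f r with ha_def
  -- Below `1` one has `xⁿ ≤ x`, so `a ≤ xⁿ (S' + B)` improves to `a / x ≤ S' + B`, whose integral
  -- is logarithmic.
  set q := min r 1 with hq
  have hq0 : 0 < q := lt_min hr one_pos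
  have hmono : ∀ s, 0 < s → s ≤ q →
      S s - a * Real.log s + B * s ≤ S q - a * Real.log q + B * q := by
    intro s hs hsq
    have hd : ∀ x, s ≤ x → x ≤ q → HasDerivAt (fun x => S x - a * Real.log x + B * x)
        (S' x - a * x⁻¹ + B * 1) x := fun x h1 h2 =>
      ((hS x (hs.trans_le h1) ((h2.trans (min_le_left _ _)).trans hrL)).sub
        ((Real.hasDerivAt_log (hs.trans_le h1).ne').const_mul a)).add
        ((hasDerivAt_id x).const_mul B)
    have : MonotoneOn (fun x => S x - a * Real.log x + B * x) (Set.Icc s q) := by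
      refine monotoneOn_of_hasDerivWithinAt_nonneg (f' := fun x => S' x - a * x⁻¹ + B * 1)
        (convex_Icc s q)
        (fun x hx => (hd x hx.1 hx.2).continuousAt.continuousWithinAt)
        (fun x hx => ?_) (fun x hx => ?_)
      · rw [interior_Icc] at hx
        exact (hd x hx.1.le hx.2.le).hasDerivWithinAt
      · rw [interior_Icc] at hx
        have hx0 : 0 < x := hs.trans hx.1
        have hx1 : x ≤ 1 := hx.2.le.trans (min_le_right _ _)
        have hxr : x ≤ r := hx.2.le.trans (min_le_left _ _)
        have h1 := hanti x hx0 hxr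
        have h2 := hfS x hx0 (hxr.trans hrL)
        have h3 : x ^ n ≤ x := by
          simpa using pow_le_pow_of_le_one hx0.le hx1 hn
        have h4 : 0 < S' x + B := by
          have : 0 < x ^ n * (S' x + B) := by linarith
          exact (pos_iff_pos_of_mul_pos this).1 (by positivity)
        have h5 : a ≤ x * (S' x + B) := by nlinarith
        have h6 : a * x⁻¹ ≤ S' x + B := by
          rw [← div_eq_mul_inv, div_le_iff₀ hx0]; linarith
        show 0 ≤ S' x - a * x⁻¹ + B * 1
        linarith
    exact this (Set.left_mem_Icc.2 hsq) (Set.right_mem_Icc.2 hsq) hsq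
  set K := S q - a * Real.log q + B * q with hK
  have hlog : ∀ s, 0 < s → s ≤ q → -(B₂ + |B| + |K|) ≤ a * Real.log s := by
    intro s hs hsq
    have h1 := hmono s hs hsq
    have h2 := (abs_le.1 (hSB s hs ((hsq.trans (min_le_left _ _)).trans hrL))).1
    have hs1 : s ≤ 1 := hsq.trans (min_le_right _ _)
    have h3 : -|B| ≤ B * s := by
      have := neg_abs_le B
      have := abs_nonneg B
      nlinarith
    have := le_abs_self K
    linarith
  have hX : ∃ s, 0 < s ∧ s ≤ q ∧ a * Real.log s < -(B₂ + |B| + |K|) := by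
    have h := (Real.tendsto_log_nhdsGT_zero.const_mul_atBot ha).eventually
      (Filter.eventually_lt_atBot (-(B₂ + |B| + |K|)))
    have h2 : ∀ᶠ s in nhdsWithin (0 : ℝ) (Set.Ioi 0), s ∈ Set.Ioc 0 q := Ioc_mem_nhdsGT hq0
    obtain ⟨s, hs1, hs2⟩ := (h.and h2).exists
    exact ⟨s, hs2.1, hs2.2, hs1⟩
  obtain ⟨s, h1, h2, h3⟩ := hX
  exact absurd (hlog s h1 h2) (not_le.2 h3)

/-! ### Conservation laws in flux form -/

section ODE

variable {n : ℕ} {α CV κ R μ₀ lam₀ : ℝ} {P U Θ : ℝ → ℝ}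

/-- `rⁿ (r/2 + U) P`, a multiple of the mass inside the ball of radius `r`. -/
def massFlux (n : ℕ) (P U : ℝ → ℝ) (r : ℝ) : ℝ := r ^ n * ((r / 2 + U r) * P r)

/-- The sum of the heat flux and of the work of the viscous stress. -/
def heatFlux (n : ℕ) (α κ μ₀ lam₀ : ℝ) (P U Θ : ℝ → ℝ) (r : ℝ) : ℝ :=
  κ * deriv Θ r + (2 * μ₀ + lam₀) * (P r ^ α * (U r * deriv U r))
    + lam₀ * n * (P r ^ α * (U r ^ 2 / r))

/-- The specific total energy. -/
def energyDensity (CV : ℝ) (U Θ : ℝ → ℝ) (r : ℝ) : ℝ := U r ^ 2 / 2 + CV * Θ r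

/-- The total energy flux through the sphere of radius `r`. -/
def energyFlux (n : ℕ) (α CV κ R μ₀ lam₀ : ℝ) (P U Θ : ℝ → ℝ) (r : ℝ) : ℝ :=
  r ^ n * (heatFlux n α κ μ₀ lam₀ P U Θ r
    - (r / 2 + U r) * P r * energyDensity CV U Θ r - R * (U r * P r * Θ r))

theorem IsShrinkerProfile.hasDerivAt_massFlux
    (h : IsShrinkerProfile (n + 1) α CV κ R μ₀ lam₀ P U Θ) {r : ℝ} (hr : 0 < r) :
    HasDerivAt (massFlux n P U) ((n + 1) / 2 * (r ^ n * P r)) r := by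
  have hP := hasDerivAt_of_contDiffOn_Ioi h.contDiffOn_P hr
  have hU := hasDerivAt_of_contDiffOn_Ioi (h.contDiffOn_U.of_le (by norm_num)) hr
  have hm := h.mass r hr
  push_cast at hm
  simp only [add_sub_cancel_right] at hm
  have hd := (hasDerivAt_pow n r).mul ((((hasDerivAt_id r).div_const 2).add hU).mul hP)
  refine hd.congr_deriv ?_
  have hrn : (n : ℝ) * r ^ (n - 1) = n / r * r ^ n := by
    cases n with
    | zero => simp
    | succ m => simp [pow_succ]; field_simp
  simp only [hrn, Pi.add_apply, id, Pi.mul_apply]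
  have hr' : n / r * r = n := div_mul_cancel₀ _ hr.ne'
  linear_combination r ^ n * hm + r ^ n * P r / 2 * hr'

/-- The energy equation is a divergence up to the scaling term: moving `r/2` inside the divergence
costs `(n+1)/2 · PE`, against the `PE` already present. -/
theorem IsShrinkerProfile.hasDerivAt_energyFlux
    (h : IsShrinkerProfile (n + 1) α CV κ R μ₀ lam₀ P U Θ) {r : ℝ} (hr : 0 < r)
    (hP0 : 0 < P r) (hUr : 0 < r / 2 + U r) :
    HasDerivAt (energyFlux n α CV κ R μ₀ lam₀ P U Θ)
      ((1 - (n + 1) / 2) * (r ^ n * (P r * energyDensity CV U Θ r))) r := by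
  have hP := hasDerivAt_of_contDiffOn_Ioi h.contDiffOn_P hr
  have hU := hasDerivAt_of_contDiffOn_Ioi (h.contDiffOn_U.of_le (by norm_num)) hr
  have hT := hasDerivAt_of_contDiffOn_Ioi (h.contDiffOn_Θ.of_le (by norm_num)) hr
  have hU2 := hasDerivAt_deriv_of_contDiffOn_Ioi h.contDiffOn_U hr
  have hT2 := hasDerivAt_deriv_of_contDiffOn_Ioi h.contDiffOn_Θ hr
  have hm := h.mass r hr
  have he := h.energy r hr
  push_cast at hm he
  simp only [add_sub_cancel_right] at hm he
  have hE := ((hU.pow 2).div_const 2).add (hT.const_mul CV)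
  have hPE := hP.mul hE
  have hF := ((hU.mul hP).mul hE).add (((hU.mul hP).mul_const R).mul hT)
  have e1 := hPE.deriv
  have e2 := hF.deriv
  simp only [Pi.mul_def, Pi.add_def, Pi.pow_def] at e1 e2
  rw [e1, e2] at he
  have hPa := hP.rpow_const (p := α) (Or.inl hP0.ne')
  -- By the mass equation the terms carrying `α` are exactly those produced by differentiating `P^α`
  -- in the viscous stress.
  have hq : (deriv U r + n / r * U r) / (1 / 2 * r + U r) = - (deriv P r / P r) := by
    rw [← neg_div, div_eq_div_iff (by linarith) hP0.ne']
    linear_combination hm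
  rw [hq] at he
  rw [Real.rpow_sub_one hP0.ne'] at hPa
  have hd := (hasDerivAt_pow n r).mul ((((hT2.const_mul κ).add
      ((hPa.mul (hU.mul hU2)).const_mul (2 * μ₀ + lam₀))).add
      ((hPa.mul ((hU.pow 2).div (hasDerivAt_id r) hr.ne')).const_mul (lam₀ * n))).sub
      (((((hasDerivAt_id r).div_const 2).add hU).mul hP).mul hE) |>.sub
      (((hU.mul hP).mul hT).const_mul R))
  refine hd.congr_deriv ?_
  have hrn : (n : ℝ) * r ^ (n - 1) = n / r * r ^ n := by
    cases n with
    | zero => simp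
    | succ m => simp [pow_succ]; field_simp
  simp only [hrn, Pi.add_apply, id, Pi.mul_apply, Pi.pow_apply, Pi.sub_apply, Pi.div_apply,
    energyDensity]
  generalize P r ^ α = p at *
  generalize deriv (deriv U) r = u2 at *
  generalize deriv (deriv Θ) r = t2 at *
  generalize deriv U r = u1 at *
  generalize deriv Θ r = t1 at *
  generalize deriv P r = p1 at *
  generalize r ^ n = rn at *
  have hrne := hr.ne'
  have hPne := hP0.ne'
  field_simp
  field_simp at he
  ring_nf
  ring_nf at he
  linear_combination (-rn) * he

/-- Subtracting `U` times the momentum equation removes the kinetic energy and all second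
derivatives of `U`; the multiple of the mass equation cleans up the derivatives of `P`. What is left
suits a maximum principle for `Θ`. -/
theorem IsShrinkerProfile.internal_energy
    (h : IsShrinkerProfile (n + 1) α CV κ R μ₀ lam₀ P U Θ) {r : ℝ} (hr : 0 < r) :
    P r * CV * (Θ r + (r / 2 + U r) * deriv Θ r)
      + R * P r * Θ r * (deriv U r + n / r * U r)
      - κ * (deriv (deriv Θ) r + n / r * deriv Θ r)
    = 2 * μ₀ * P r ^ α * (deriv U r ^ 2 + n / r ^ 2 * U r ^ 2)
      + lam₀ * P r ^ α * (deriv U r + n / r * U r) ^ 2 := by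
  have hP := hasDerivAt_of_contDiffOn_Ioi h.contDiffOn_P hr
  have hU := hasDerivAt_of_contDiffOn_Ioi (h.contDiffOn_U.of_le (by norm_num)) hr
  have hT := hasDerivAt_of_contDiffOn_Ioi (h.contDiffOn_Θ.of_le (by norm_num)) hr
  have hm := h.mass r hr
  have hmo := h.momentum r hr
  have he := h.energy r hr
  push_cast at hm he hmo
  simp only [add_sub_cancel_right] at hm he hmo
  have hE := ((hU.pow 2).div_const 2).add (hT.const_mul CV)
  have hPE := hP.mul hE
  have hF := ((hU.mul hP).mul hE).add (((hU.mul hP).mul_const R).mul hT)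
  have e1 := hPE.deriv
  have e2 := hF.deriv
  have e3 := (hP.mul hU).deriv
  have e4 := (hP.mul (hU.pow 2)).deriv
  have e5 := ((hP.mul_const R).mul hT).deriv
  simp only [Pi.mul_def, Pi.add_def, Pi.pow_def] at e1 e2 e3 e4 e5
  rw [e1, e2] at he
  rw [e3, e4, e5] at hmo
  linear_combination he - U r * hmo + (U r ^ 2 / 2 - CV * Θ r) * hm

end ODE

/-! ### Integrating the viscous work -/

/-- A primitive of `x (1/2 + x)^{-α}`. -/
def workPrimitive (α v : ℝ) : ℝ := ∫ x in (0 : ℝ)..v, x * (1 / 2 + x) ^ (-α)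

theorem rpow_le_four {α w : ℝ} (hα0 : 0 < α) (hα1 : α < 1) (hw : 1 / 4 ≤ w) : w ^ (-α) ≤ 4 := by
  calc w ^ (-α) ≤ (1 / 4 : ℝ) ^ (-α) :=
        Real.rpow_le_rpow_of_nonpos (by norm_num) hw (by linarith)
    _ = 4 ^ α := by
        rw [Real.rpow_neg (by norm_num), ← Real.inv_rpow (by norm_num)]; norm_num
    _ ≤ 4 ^ (1 : ℝ) := Real.rpow_le_rpow_of_exponent_le (by norm_num) hα1.le
    _ = 4 := by norm_num

theorem continuousAt_workIntegrand {α x : ℝ} (hx : |x| < 1 / 2) :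
    ContinuousAt (fun x : ℝ => x * (1 / 2 + x) ^ (-α)) x := by
  have : 1 / 2 + x ≠ 0 := by linarith [(abs_lt.1 hx).1]
  exact continuousAt_id.mul ((continuousAt_const.add continuousAt_id).rpow_const (Or.inl this))

theorem hasDerivAt_workPrimitive {α v : ℝ} (hv : |v| < 1 / 2) :
    HasDerivAt (workPrimitive α) (v * (1 / 2 + v) ^ (-α)) v := by
  have hlt : ∀ x ∈ Set.uIcc 0 v, |x| < 1 / 2 := fun x hx => by
    have := Set.abs_sub_left_of_mem_uIcc hx
    simp only [sub_zero] at this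
    linarith
  refine intervalIntegral.integral_hasDerivAt_right ?_ ?_ (continuousAt_workIntegrand hv)
  · exact ContinuousOn.intervalIntegrable fun x hx =>
      (continuousAt_workIntegrand (hlt x hx)).continuousWithinAt
  · have ho : IsOpen {x : ℝ | |x| < 1 / 2} := isOpen_lt continuous_abs continuous_const
    exact ContinuousOn.stronglyMeasurableAtFilter ho
      (fun x hx => (continuousAt_workIntegrand hx).continuousWithinAt) v hv

theorem abs_workPrimitive_le {α v : ℝ} (hα0 : 0 < α) (hα1 : α < 1) (hv : |v| ≤ 1 / 4) :
    |workPrimitive α v| ≤ 4 * v ^ 2 := by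
  have h := intervalIntegral.norm_integral_le_of_norm_le_const (a := 0) (b := v)
    (f := fun x : ℝ => x * (1 / 2 + x) ^ (-α)) (C := |v| * 4) (fun x hx => by
      have h1 : |x| ≤ |v| := by
        have := Set.abs_sub_left_of_mem_uIcc (Set.uIoc_subset_uIcc hx)
        simpa using this
      have h2 : 1 / 4 ≤ 1 / 2 + x := by linarith [(abs_le.1 (h1.trans hv)).1]
      rw [norm_mul, Real.norm_eq_abs, Real.norm_eq_abs,
        abs_of_nonneg (Real.rpow_nonneg (by linarith) _)]
      gcongr
      exact rpow_le_four hα0 hα1 h2)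
  rw [sub_zero, Real.norm_eq_abs] at h
  calc |workPrimitive α v| ≤ |v| * 4 * |v| := h
    _ = 4 * v ^ 2 := by rw [← sq_abs v]; ring

/-- A primitive of the viscous work `P^α U U'`, up to terms that do not involve `U'`. -/
def viscousWork (α : ℝ) (P U : ℝ → ℝ) (r : ℝ) : ℝ :=
  (P r * (1 / 2 + U r / r)) ^ α * (r ^ 2 * workPrimitive α (U r / r))

theorem abs_viscousWork_le {α : ℝ} (hα0 : 0 < α) (hα1 : α < 1) {P U : ℝ → ℝ} {r : ℝ}
    (hP0 : 0 < P r) (hP1 : P r ≤ 1) (hV : |U r / r| ≤ 1 / 4) :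
    |viscousWork α P U r| ≤ 4 * r ^ 2 * (U r / r) ^ 2 := by
  have hV' := abs_le.1 hV
  have hw0 : 0 < 1 / 2 + U r / r := by linarith
  have h1 : (P r * (1 / 2 + U r / r)) ^ α ≤ 1 :=
    Real.rpow_le_one (by positivity) (by nlinarith) hα0.le
  have h0 : 0 ≤ (P r * (1 / 2 + U r / r)) ^ α := by positivity
  have h2 := abs_workPrimitive_le hα0 hα1 hV
  rw [viscousWork, abs_mul, abs_mul, abs_of_nonneg h0, abs_of_nonneg (sq_nonneg r)]
  calc _ ≤ 1 * (r ^ 2 * (4 * (U r / r) ^ 2)) := by gcongr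
    _ = _ := by ring

section ODE

variable {n : ℕ} {α CV κ R μ₀ lam₀ : ℝ} {P U Θ : ℝ → ℝ}

/-- With `V = U/r` and `Q = P(1/2 + V)`, the work `P^α U U'` equals `Q^α (1/2 + V)^{-α} rV (V +
rV')`. The `V'` part integrates through `workPrimitive`, because `Q'` involves neither `U'` nor
`P'`. -/
theorem IsShrinkerProfile.hasDerivAt_viscousWork
    (h : IsShrinkerProfile (n + 1) α CV κ R μ₀ lam₀ P U Θ) {r : ℝ} (hr : 0 < r)
    (hP0 : 0 < P r) (hV : |U r / r| ≤ 1 / 4) :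
    HasDerivAt (viscousWork α P U)
      (P r ^ α * (U r * deriv U r) - P r ^ α * (r * (U r / r) ^ 2)
        + r * (P r * (1 / 2 + U r / r)) ^ α * workPrimitive α (U r / r)
          * (2 - α * (n + 1) * (U r / r / (1 / 2 + U r / r)))) r := by
  have hP := hasDerivAt_of_contDiffOn_Ioi h.contDiffOn_P hr
  have hU := hasDerivAt_of_contDiffOn_Ioi (h.contDiffOn_U.of_le (by norm_num)) hr
  have hm := h.mass r hr
  push_cast at hm
  simp only [add_sub_cancel_right] at hm
  have hw0 : 0 < 1 / 2 + U r / r := by linarith [(abs_le.1 hV).1]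
  have hQ0 : 0 < P r * (1 / 2 + U r / r) := by positivity
  have hVd := hU.div (hasDerivAt_id r) hr.ne'
  have hQ := (hP.mul (hVd.const_add (1 / 2))).rpow_const (p := α) (Or.inl hQ0.ne')
  have hΦ := (hasDerivAt_workPrimitive (α := α)
    (show |(U / id : ℝ → ℝ) r| < 1 / 2 from lt_of_le_of_lt hV (by norm_num))).comp r hVd
  have hd := hQ.mul ((hasDerivAt_pow 2 r).mul hΦ)
  refine (hd.congr_deriv ?_)
  simp only [Pi.mul_apply, Pi.div_apply, id, Function.comp]
  -- The mass equation in terms of `Q`: `r Q' = -(n+1) V P`.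
  have hQd : deriv P r * (1 / 2 + U r / r) + P r * ((deriv U r * r - U r * 1) / r ^ 2)
      = -((n + 1) * (U r / r) * P r / r) := by
    field_simp
    have hm' := congrArg (fun x => x * r) hm
    field_simp at hm'
    linear_combination hm'
  rw [hQd, Real.rpow_sub_one hQ0.ne']
  have hpw : P r ^ α = (P r * (1 / 2 + U r / r)) ^ α * (1 / 2 + U r / r) ^ (-α) := by
    rw [Real.mul_rpow hP0.le hw0.le, mul_assoc, ← Real.rpow_add hw0]
    simp
  rw [hpw]
  generalize (P r * (1 / 2 + U r / r)) ^ α = q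
  generalize (1 / 2 + U r / r) ^ (-α) = z
  generalize workPrimitive α (U r / r) = f
  have hUV : U r = U r / r * r := by field_simp
  generalize U r / r = v at *
  rw [hUV]
  have := hP0.ne'
  have := hw0.ne'
  have := hr.ne'
  field_simp
  ring

/-- A primitive of the heat flux, up to terms quadratic in `U`. -/
def heatPotential (α κ μ₀ lam₀ : ℝ) (P U Θ : ℝ → ℝ) (r : ℝ) : ℝ :=
  κ * Θ r + (2 * μ₀ + lam₀) * viscousWork α P U r

/-- Every leftover term carries `V²`, directly or through `|workPrimitive| ≤ 4V²`, with weights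
`P^α` and `Q^α` at most `1`. The heat flux, which contains `U'`, is thus controlled without any
bound on `U'`. -/
theorem IsShrinkerProfile.exists_hasDerivAt_heatPotential (hα0 : 0 < α) (hα1 : α < 1)
    (hμ₀ : 0 < μ₀) (hlam₀ : 0 < lam₀)
    (h : IsShrinkerProfile (n + 1) α CV κ R μ₀ lam₀ P U Θ) {r : ℝ} (hr : 0 < r)
    (hP0 : 0 < P r) (hP1 : P r ≤ 1) (hV : |U r / r| ≤ 1 / 4) :
    HasDerivAt (heatPotential α κ μ₀ lam₀ P U Θ) (deriv (heatPotential α κ μ₀ lam₀ P U Θ) r) r ∧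
      |deriv (heatPotential α κ μ₀ lam₀ P U Θ) r - heatFlux n α κ μ₀ lam₀ P U Θ r|
        ≤ (lam₀ * n + (2 * μ₀ + lam₀) * (4 * n + 13)) * (r * (U r / r) ^ 2) := by
  have hT := hasDerivAt_of_contDiffOn_Ioi (h.contDiffOn_Θ.of_le (by norm_num)) hr
  have hd := (hT.const_mul κ).add
    ((h.hasDerivAt_viscousWork hr hP0 hV).const_mul (2 * μ₀ + lam₀))
  have hd' : HasDerivAt (heatPotential α κ μ₀ lam₀ P U Θ) _ r := hd
  rw [hd'.deriv]
  refine ⟨hd', ?_⟩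
  have hV' := abs_le.1 hV
  have hw0 : 0 < 1 / 2 + U r / r := by linarith
  have hUV : U r = U r / r * r := by field_simp
  have hq1 : (P r * (1 / 2 + U r / r)) ^ α ≤ 1 :=
    Real.rpow_le_one (by positivity) (by nlinarith) hα0.le
  have hq0 : 0 ≤ (P r * (1 / 2 + U r / r)) ^ α := by positivity
  have hp1 : P r ^ α ≤ 1 := Real.rpow_le_one hP0.le hP1 hα0.le
  have hp0 : 0 ≤ P r ^ α := by positivity
  have hf := abs_workPrimitive_le hα0 hα1 hV
  have hz : |2 - α * (n + 1) * (U r / r / (1 / 2 + U r / r))| ≤ n + 3 := by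
    have h1 : |U r / r / (1 / 2 + U r / r)| ≤ 1 := by
      rw [abs_div, abs_of_pos hw0, div_le_one hw0]; linarith
    calc _ ≤ |(2 : ℝ)| + |α * (n + 1) * (U r / r / (1 / 2 + U r / r))| := abs_sub _ _
      _ = 2 + α * (n + 1) * |U r / r / (1 / 2 + U r / r)| := by
        rw [abs_mul, abs_of_nonneg (by positivity : (0 : ℝ) ≤ α * (n + 1))]; norm_num
      _ ≤ 2 + 1 * (n + 1) * 1 := by gcongr
      _ = n + 3 := by ring
  have key : |r * (P r * (1 / 2 + U r / r)) ^ α * workPrimitive α (U r / r)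
      * (2 - α * (n + 1) * (U r / r / (1 / 2 + U r / r)))| ≤ r * 1 * (4 * (U r / r) ^ 2) * (n + 3) := by
    rw [abs_mul, abs_mul, abs_mul, abs_of_pos hr, abs_of_nonneg hq0]
    gcongr
  have hpv : P r ^ α * (r * (U r / r) ^ 2) ≤ 1 * (r * (U r / r) ^ 2) := by gcongr
  have hpv0 : 0 ≤ P r ^ α * (r * (U r / r) ^ 2) := by positivity
  have hU2 : U r ^ 2 / r = r * (U r / r) ^ 2 := by field_simp
  rw [heatFlux, hU2]
  generalize r * (P r * (1 / 2 + U r / r)) ^ α * workPrimitive α (U r / r)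
      * (2 - α * (n + 1) * (U r / r / (1 / 2 + U r / r))) = X at *
  generalize hY : r * (U r / r) ^ 2 = Y at *
  have hkey : |X| ≤ Y * (4 * n + 12) := by
    refine key.trans (le_of_eq ?_); rw [← hY]; ring
  have e : κ * deriv Θ r + (2 * μ₀ + lam₀) * (P r ^ α * (U r * deriv U r) - P r ^ α * Y + X)
      - (κ * deriv Θ r + (2 * μ₀ + lam₀) * (P r ^ α * (U r * deriv U r)) + lam₀ * n * (P r ^ α * Y))
      = (2 * μ₀ + lam₀) * (X - P r ^ α * Y) - lam₀ * n * (P r ^ α * Y) := by ring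
  rw [e]
  have hln : 0 ≤ lam₀ * n := by positivity
  calc _ ≤ |(2 * μ₀ + lam₀) * (X - P r ^ α * Y)| + |lam₀ * n * (P r ^ α * Y)| := abs_sub _ _
    _ = (2 * μ₀ + lam₀) * |X - P r ^ α * Y| + lam₀ * n * (P r ^ α * Y) := by
      rw [abs_mul, abs_mul, abs_of_nonneg hln, abs_of_nonneg hpv0, abs_of_pos (by positivity)]
    _ ≤ (2 * μ₀ + lam₀) * (Y * (4 * n + 12) + 1 * Y) + lam₀ * n * (1 * Y) := by
      gcongr
      calc _ ≤ |X| + |P r ^ α * Y| := abs_sub _ _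
        _ ≤ _ := by rw [abs_of_nonneg hpv0]; gcongr
    _ = _ := by ring

/-! ### The heat flux near the origin -/

/-- On a ball where the total energy is within `e` of a constant `c`, the heat flux is the one
produced by the energy `c`, up to errors controlled by `e` and by the pressure work. -/
theorem IsShrinkerProfile.heatFlux_estimate (hn : 1 ≤ n) (hα0 : 0 < α) (hα1 : α < 1)
    (hκ : 0 < κ) (hR : 0 < R) (hμ₀ : 0 < μ₀) (hlam₀ : 0 < lam₀)
    (h : IsShrinkerProfile (n + 1) α CV κ R μ₀ lam₀ P U Θ) {L M c e : ℝ}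
    (hP0 : ∀ r, 0 < r → r ≤ L → 0 < P r) (hP1 : ∀ r, 0 < r → r ≤ L → P r ≤ 1)
    (hV : ∀ r, 0 < r → r ≤ L → |U r / r| ≤ 1 / 4) (hM : ∀ r, 0 < r → r ≤ L → |Θ r| ≤ M)
    (hE : ∀ r, 0 < r → r ≤ L → |energyDensity CV U Θ r - c| ≤ e)
    {r : ℝ} (hr : 0 < r) (hrL : r ≤ L) :
    |heatFlux n α κ μ₀ lam₀ P U Θ r - (r / 2 + U r) * P r * energyDensity CV U Θ r
      - R * (U r * P r * Θ r) + (n - 1) / (n + 1) * c * ((r / 2 + U r) * P r)|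
      ≤ (n - 1) / (n + 1) * e * ((r / 2 + U r) * P r) := by
  -- The ratio of the two flux derivatives, so that `c` cancels in the derivative of energy flux
  -- plus `k c` times mass flux.
  set k : ℝ := (n - 1) / (n + 1) with hk
  have hn' : (1 : ℝ) ≤ n := by exact_mod_cast hn
  have hk0 : 0 ≤ k := div_nonneg (by linarith) (by linarith)
  have hkn : k * ((n + 1) / 2) = (n - 1) / 2 := by rw [hk]; field_simp
  have hL : 0 < L := hr.trans_le hrL
  have hM0 : 0 ≤ M := (abs_nonneg _).trans (hM r hr hrL)
  have he0 : 0 ≤ e := (abs_nonneg _).trans (hE r hr hrL)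
  have hY : ∀ r, 0 < r → r ≤ L → 0 < r / 2 + U r ∧ 0 < (r / 2 + U r) * P r ∧
      (r / 2 + U r) * P r ≤ L ∧ |U r| ≤ L := by
    intro r hr hrL
    have hUV : U r = U r / r * r := by field_simp
    have h1 := abs_le.1 (hV r hr hrL)
    have h2 : |U r| ≤ 1 / 4 * r := by
      rw [hUV, abs_mul, abs_of_pos hr]
      exact mul_le_mul_of_nonneg_right (hV r hr hrL) hr.le
    have h3 := abs_le.1 h2
    have h4 : 0 < r / 2 + U r := by linarith
    refine ⟨h4, mul_pos h4 (hP0 r hr hrL), ?_, by linarith⟩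
    calc _ ≤ L * 1 := mul_le_mul (by linarith) (hP1 r hr hrL) (hP0 r hr hrL).le hL.le
      _ = L := mul_one L
  set K := lam₀ * n + (2 * μ₀ + lam₀) * (4 * n + 13) with hK
  have hK0 : 0 ≤ K := by positivity
  -- The signs `s = 1` and `s = -1` give the two halves of the absolute value bound.
  have main : ∀ s : ℝ, |s| = 1 → ∀ r, 0 < r → r ≤ L →
      s * (energyFlux n α CV κ R μ₀ lam₀ P U Θ r + k * c * massFlux n P U r)
        - k * e * massFlux n P U r ≤ 0 := by
    intro s hs r hr hrL
    have hsle : ∀ x, s * x ≤ |x| := fun x => by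
      calc s * x ≤ |s * x| := le_abs_self _
        _ = |x| := by rw [abs_mul, hs, one_mul]
    refine nonpos_of_antitone_flux (n := n) (L := L)
      (f := fun r => s * (energyFlux n α CV κ R μ₀ lam₀ P U Θ r + k * c * massFlux n P U r)
        - k * e * massFlux n P U r)
      (f' := fun r => s * ((1 - (n + 1) / 2) * (r ^ n * (P r * energyDensity CV U Θ r))
        + k * c * ((n + 1) / 2 * (r ^ n * P r))) - k * e * ((n + 1) / 2 * (r ^ n * P r)))
      (S := fun r => s * heatPotential α κ μ₀ lam₀ P U Θ r)
      (S' := fun r => s * deriv (heatPotential α κ μ₀ lam₀ P U Θ) r)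
      (B := L * (|c| + e) + R * (L * 1 * M) + k * |c| * L + K * (L * (1 / 4) ^ 2))
      (B₂ := κ * M + (2 * μ₀ + lam₀) * (4 * L ^ 2 * (1 / 4) ^ 2)) hn ?_ ?_ ?_ ?_ ?_ hr hrL
    · intro r hr hrL
      exact (((h.hasDerivAt_energyFlux hr (hP0 r hr hrL) (hY r hr hrL).1).add
        ((h.hasDerivAt_massFlux hr).const_mul (k * c))).const_mul s).sub
        ((h.hasDerivAt_massFlux hr).const_mul (k * e))
    · intro r hr hrL
      have h1 := hsle (-(energyDensity CV U Θ r - c))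
      rw [abs_neg] at h1
      have h2 := hE r hr hrL
      have h3 : 0 ≤ r ^ n * P r * ((n - 1) / 2) :=
        mul_nonneg (mul_pos (pow_pos hr n) (hP0 r hr hrL)).le (by linarith)
      have h4 : r ^ n * P r * ((n - 1) / 2) * (s * (-(energyDensity CV U Θ r - c)) - e) ≤ 0 :=
        mul_nonpos_of_nonneg_of_nonpos h3 (by linarith)
      refine le_trans (le_of_eq ?_) h4
      show s * ((1 - (n + 1) / 2) * (r ^ n * (P r * energyDensity CV U Θ r))
        + k * c * ((n + 1) / 2 * (r ^ n * P r))) - k * e * ((n + 1) / 2 * (r ^ n * P r)) = _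
      linear_combination (s * c - e) * (r ^ n * P r) * hkn
    · intro r hr hrL
      exact (h.exists_hasDerivAt_heatPotential hα0 hα1 hμ₀ hlam₀ hr (hP0 r hr hrL)
        (hP1 r hr hrL) (hV r hr hrL)).1.const_mul s
    · intro r hr hrL
      have h1 := (h.exists_hasDerivAt_heatPotential hα0 hα1 hμ₀ hlam₀ hr (hP0 r hr hrL)
        (hP1 r hr hrL) (hV r hr hrL)).2
      obtain ⟨-, hY0, hYL, hUL⟩ := hY r hr hrL
      have hV2 : (U r / r) ^ 2 ≤ (1 / 4) ^ 2 := sq_le_sq.2 (by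
        rw [abs_of_pos (by norm_num : (0 : ℝ) < 1 / 4)]; exact hV r hr hrL)
      have h2 : K * (r * (U r / r) ^ 2) ≤ K * (L * (1 / 4) ^ 2) := by gcongr
      have h3 := hsle (-(deriv (heatPotential α κ μ₀ lam₀ P U Θ) r
        - heatFlux n α κ μ₀ lam₀ P U Θ r))
      rw [abs_neg] at h3
      have h4 : s * (-((r / 2 + U r) * P r * energyDensity CV U Θ r)) ≤ L * (|c| + e) := by
        refine (hsle _).trans ?_
        rw [abs_neg, abs_mul, abs_of_pos hY0]
        gcongr
        calc _ = |c + (energyDensity CV U Θ r - c)| := by ring_nf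
          _ ≤ |c| + |energyDensity CV U Θ r - c| := abs_add_le _ _
          _ ≤ _ := by gcongr; exact hE r hr hrL
      have h5 : s * (-(R * (U r * P r * Θ r))) ≤ R * (L * 1 * M) := by
        refine (hsle _).trans ?_
        rw [abs_neg, abs_mul, abs_mul, abs_mul, abs_of_pos hR, abs_of_pos (hP0 r hr hrL)]
        have := hP1 r hr hrL
        have := hM r hr hrL
        have := (hP0 r hr hrL).le
        gcongr
      have h6 : s * (k * c * ((r / 2 + U r) * P r)) ≤ k * |c| * L := by
        refine (hsle _).trans ?_
        rw [abs_mul, abs_mul, abs_of_pos hY0, abs_of_nonneg hk0]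
        gcongr
      have h7 : 0 ≤ k * e * ((r / 2 + U r) * P r) := by positivity
      show s * (r ^ n * (heatFlux n α κ μ₀ lam₀ P U Θ r
        - (r / 2 + U r) * P r * energyDensity CV U Θ r - R * (U r * P r * Θ r))
        + k * c * (r ^ n * ((r / 2 + U r) * P r))) - k * e * (r ^ n * ((r / 2 + U r) * P r)) ≤ _
      have h8 : s * heatFlux n α κ μ₀ lam₀ P U Θ r
          + s * (-((r / 2 + U r) * P r * energyDensity CV U Θ r))
          + s * (-(R * (U r * P r * Θ r))) + s * (k * c * ((r / 2 + U r) * P r))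
          - k * e * ((r / 2 + U r) * P r)
          ≤ s * deriv (heatPotential α κ μ₀ lam₀ P U Θ) r
            + (L * (|c| + e) + R * (L * 1 * M) + k * |c| * L + K * (L * (1 / 4) ^ 2)) := by
        linarith
      refine le_trans (le_of_eq ?_) (mul_le_mul_of_nonneg_left h8 (pow_pos hr n).le)
      ring
    · intro r hr hrL
      have hV2 : (U r / r) ^ 2 ≤ (1 / 4) ^ 2 := sq_le_sq.2 (by
        rw [abs_of_pos (by norm_num : (0 : ℝ) < 1 / 4)]; exact hV r hr hrL)
      have h1 := abs_viscousWork_le hα0 hα1 (hP0 r hr hrL) (hP1 r hr hrL) (hV r hr hrL)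
      rw [abs_mul, hs, one_mul, heatPotential]
      calc _ ≤ |κ * Θ r| + |(2 * μ₀ + lam₀) * viscousWork α P U r| := abs_add_le _ _
        _ = κ * |Θ r| + (2 * μ₀ + lam₀) * |viscousWork α P U r| := by
          rw [abs_mul, abs_mul, abs_of_pos hκ, abs_of_pos (by positivity : 0 < 2 * μ₀ + lam₀)]
        _ ≤ _ := by
          gcongr
          · exact hM r hr hrL
          · exact h1.trans (by gcongr)
  have hrn : 0 < r ^ n := pow_pos hr n
  have m1 := main 1 (by norm_num) r hr hrL
  have m2 := main (-1) (by norm_num) r hr hrL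
  simp only [energyFlux, massFlux] at m1 m2
  rw [abs_le]
  constructor
  · refine le_of_mul_le_mul_left ?_ hrn
    linarith
  · refine le_of_mul_le_mul_left ?_ hrn
    linarith

/-! ### Maximum principle away from the origin -/

/-- The maximum principle where the density is bounded below: `|Θ|` has no positive maximum at a
point where `U'` vanishes along with `Θ'`. -/
theorem IsShrinkerProfile.not_isMax (hκ : 0 < κ) (hR : 0 < R)
    (hμ₀ : 0 < μ₀) (hlam₀ : 0 < lam₀)
    (h : IsShrinkerProfile (n + 1) α CV κ R μ₀ lam₀ P U Θ) {C M Pε r : ℝ} (hr : 0 < r)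
    (hC0 : 0 < C) (hC1 : C ≤ 1) (hMC : M ≤ C) (hPε : 0 < Pε) (hP : Pε ≤ P r) (hα1 : α < 1)
    (hC : C * (R * n + Pε ^ (α - 1) * (2 * μ₀ * n + lam₀ * n ^ 2)) < CV)
    (hU : |U r| ≤ C * |r * Θ r|) (hU' : |deriv U r| ≤ C * |r * deriv Θ r|)
    (hM0 : 0 < M) (hΘ : |Θ r| = M) (hmax : ∀ s, 0 < s → |Θ s| ≤ M) : False := by
  have hP0 : 0 < P r := hPε.trans_le hP
  obtain ⟨s, hs, hsM⟩ : ∃ s : ℝ, |s| = 1 ∧ s * Θ r = M := by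
    rcases le_total 0 (Θ r) with h0 | h0
    · exact ⟨1, by norm_num, by rw [one_mul, ← hΘ, abs_of_nonneg h0]⟩
    · exact ⟨-1, by norm_num, by rw [← hΘ, abs_of_nonpos h0]; ring⟩
  have hsle : ∀ x, s * x ≤ |x| := fun x => by
    calc s * x ≤ |s * x| := le_abs_self _
      _ = |x| := by rw [abs_mul, hs, one_mul]
  have hT : ∀ x, 0 < x → HasDerivAt (fun x => s * Θ x) (s * deriv Θ x) x := fun x hx =>
    (hasDerivAt_of_contDiffOn_Ioi (h.contDiffOn_Θ.of_le (by norm_num)) hx).const_mul s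
  have hT2 : HasDerivAt (fun x => s * deriv Θ x) (s * deriv (deriv Θ) r) r :=
    (hasDerivAt_deriv_of_contDiffOn_Ioi h.contDiffOn_Θ hr).const_mul s
  have hlm : IsLocalMax (fun x => s * Θ x) r := by
    filter_upwards [Ioi_mem_nhds hr] with x hx
    rw [hsM]
    exact (hsle _).trans (hmax x hx)
  have hd0 : s * deriv Θ r = 0 := hlm.hasDerivAt_eq_zero (hT r hr)
  have hs0 : s ≠ 0 := by rintro rfl; simp at hs
  have hΘ' : deriv Θ r = 0 := (mul_eq_zero.1 hd0).resolve_left hs0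
  have hUz : deriv U r = 0 := by
    rw [hΘ', mul_zero, abs_zero, mul_zero] at hU'
    exact abs_nonpos_iff.1 hU'
  have hderiv : deriv (fun x => s * Θ x) =ᶠ[nhds r] fun x => s * deriv Θ x := by
    filter_upwards [Ioi_mem_nhds hr] with x hx using (hT x hx).deriv
  have hdd : deriv (deriv (fun x => s * Θ x)) r = s * deriv (deriv Θ) r := by
    rw [hderiv.deriv_eq, hT2.deriv]
  have h2 : s * deriv (deriv Θ) r ≤ 0 := by
    -- A positive second derivative would make `r` a local minimum too, so `sΘ` would be locally
    -- constant.
    by_contra! hpos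
    have hmin : IsLocalMin (fun x => s * Θ x) r :=
      isLocalMin_of_deriv_deriv_pos (by rw [hdd]; exact hpos)
        (by rw [(hT r hr).deriv, hd0]) (hT r hr).continuousAt
    have hconst : (fun x => s * Θ x) =ᶠ[nhds r] fun _ => s * Θ r := by
      filter_upwards [hlm, hmin] with x h1 h2 using le_antisymm h1 h2
    have : deriv (deriv (fun x => s * Θ x)) r = 0 := by
      rw [hconst.deriv.deriv_eq]; simp
    rw [hdd] at this
    exact hpos.ne' this
  have heq := h.internal_energy hr
  rw [hΘ', hUz] at heq
  have hUV : U r = U r / r * r := by field_simp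
  have hVb : |U r / r| ≤ C * M := by
    rw [abs_div, abs_of_pos hr, div_le_iff₀ hr]
    rw [abs_mul, abs_of_pos hr, hΘ] at hU
    linarith
  have heq' : κ * (s * deriv (deriv Θ) r) = P r * CV * M + R * P r * M * n * (U r / r)
      - s * (P r ^ α * (2 * μ₀ * n + lam₀ * n ^ 2) * (U r / r) ^ 2) := by
    rw [← hsM]
    linear_combination (-s) * heq
  -- Pulling out a full factor `P` lets the viscous heating be compared with the damping `P CV M`.
  have hpa : P r ^ α ≤ P r * Pε ^ (α - 1) := by
    calc P r ^ α = P r * P r ^ (α - 1) := by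
          rw [Real.rpow_sub_one hP0.ne']; field_simp
      _ ≤ _ := mul_le_mul_of_nonneg_left
          (Real.rpow_le_rpow_of_nonpos hPε hP (by linarith)) hP0.le
  have hM1 : M ≤ 1 := hMC.trans hC1
  have hV2 : (U r / r) ^ 2 ≤ C * M := by
    rw [← sq_abs]
    have h1 : |U r / r| ≤ 1 := hVb.trans (by nlinarith)
    nlinarith [abs_nonneg (U r / r)]
  have hk0 : 0 ≤ 2 * μ₀ * n + lam₀ * (n : ℝ) ^ 2 := by positivity
  have t1 : -(R * P r * M * n * (U r / r)) ≤ R * P r * M * n * (C * 1) := by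
    rw [← mul_neg]
    have : -(U r / r) ≤ C * 1 := ((neg_le_abs _).trans hVb).trans (by gcongr)
    gcongr
  have t2 : s * (P r ^ α * (2 * μ₀ * n + lam₀ * n ^ 2) * (U r / r) ^ 2)
      ≤ P r * Pε ^ (α - 1) * (2 * μ₀ * n + lam₀ * n ^ 2) * (C * M) := by
    refine (hsle _).trans ?_
    rw [abs_of_nonneg (by positivity)]
    gcongr
  have t3 : P r * M * (C * (R * n + Pε ^ (α - 1) * (2 * μ₀ * n + lam₀ * n ^ 2)))
      < P r * M * CV := by gcongr
  have t4 : κ * (s * deriv (deriv Θ) r) ≤ 0 := mul_nonpos_of_nonneg_of_nonpos hκ.le h2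
  linarith

/-! ### The temperature near the origin -/

/-- The constant in the comparison of `heatFlux` with the derivative of `heatPotential`. -/
def workConst (n : ℕ) (μ₀ lam₀ : ℝ) : ℝ := lam₀ * n + (2 * μ₀ + lam₀) * (4 * n + 13)

/-- If the temperature is bounded by `M` on `(0, 2ε]` and the velocity is small compared with it,
then `heatPotential` and `κ Θ` have nearly the same increments. -/
theorem abs_heatPotential_sub_le (hα0 : 0 < α) (hα1 : α < 1) (hμ₀ : 0 < μ₀) (hlam₀ : 0 < lam₀)
    {ε C M r : ℝ} (hr : 0 < r) (hrε : r ≤ 2 * ε) (hP0 : 0 < P r) (hP1 : P r ≤ 1)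
    (hV : |U r / r| ≤ 1 / 4) (hV2 : (U r / r) ^ 2 ≤ C * M) :
    |heatPotential α κ μ₀ lam₀ P U Θ r - κ * Θ r|
      ≤ (2 * μ₀ + lam₀) * (16 * ε ^ 2 * (C * M)) := by
  have h1 := abs_viscousWork_le hα0 hα1 hP0 hP1 hV
  have h2 : r ^ 2 ≤ (2 * ε) ^ 2 := by gcongr
  rw [heatPotential, add_sub_cancel_left, abs_mul, abs_of_pos (by positivity : 0 < 2 * μ₀ + lam₀)]
  gcongr
  calc _ ≤ 4 * r ^ 2 * (U r / r) ^ 2 := h1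
    _ ≤ 4 * (2 * ε) ^ 2 * (C * M) := by gcongr
    _ = _ := by ring

/-- With a small density and a velocity small compared with the temperature, the temperature is
nearly constant on `(0, 2ε]`. -/
theorem IsShrinkerProfile.oscillation_le (hn : 1 ≤ n) (hα0 : 0 < α) (hα1 : α < 1)
    (hCV : 0 < CV) (hκ : 0 < κ) (hR : 0 < R) (hμ₀ : 0 < μ₀) (hlam₀ : 0 < lam₀)
    (h : IsShrinkerProfile (n + 1) α CV κ R μ₀ lam₀ P U Θ) {ε C₁ C M : ℝ}
    (hε : 0 < ε) (hC0 : 0 < C) (hC1 : C ≤ 1 / 2) (hM0 : 0 < M) (hMC : M ≤ C)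
    (hP0 : ∀ r, 0 < r → r ≤ 2 * ε → 0 < P r) (hP1 : ∀ r, 0 < r → r ≤ 2 * ε → P r ≤ 1)
    (hPC : ∀ r, 0 < r → r ≤ 2 * ε → P r ≤ C₁)
    (hV : ∀ r, 0 < r → r ≤ 2 * ε → |U r / r| ≤ C * M)
    (hΘ : ∀ r, 0 < r → r ≤ 2 * ε → |Θ r| ≤ M)
    (hsmall₁ : C₁ * (4 * ε ^ 2 * (2 * (CV + 2 * ε ^ 2) + R)) ≤ κ / (16 * (n + 1)))
    (hsmall₂ : C * (4 * ε ^ 2 * workConst n μ₀ lam₀ + 32 * (2 * μ₀ + lam₀) * ε ^ 2)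
      ≤ κ / (16 * (n + 1)))
    {r r' : ℝ} (hr : 0 < r) (hrε : r ≤ 2 * ε) (hr' : 0 < r') (hrε' : r' ≤ 2 * ε) :
    |Θ r' - Θ r| ≤ M / (8 * (n + 1)) := by
  have hM1 : M ≤ 1 / 2 := hMC.trans hC1
  have hCM : C * M ≤ 1 / 4 := by nlinarith
  have hV4 : ∀ r, 0 < r → r ≤ 2 * ε → |U r / r| ≤ 1 / 4 := fun r hr hrε => (hV r hr hrε).trans hCM
  have hV2 : ∀ r, 0 < r → r ≤ 2 * ε → (U r / r) ^ 2 ≤ C * M := fun r hr hrε => by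
    rw [← sq_abs]
    nlinarith [abs_nonneg (U r / r), hV r hr hrε, hV4 r hr hrε]
  have hC₁ : 0 < C₁ := (hP0 r hr hrε).trans_le (hPC r hr hrε)
  have hK0 : 0 ≤ workConst n μ₀ lam₀ := by unfold workConst; positivity
  have hE : ∀ r, 0 < r → r ≤ 2 * ε → |energyDensity CV U Θ r - 0| ≤ (CV + 2 * ε ^ 2) * M := by
    intro r hr hrε
    have hUV : U r ^ 2 = r ^ 2 * (U r / r) ^ 2 := by field_simp
    have h1 : U r ^ 2 ≤ (2 * ε) ^ 2 * (1 * M) := by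
      rw [hUV]
      have := hV2 r hr hrε
      have : C * M ≤ 1 * M := by gcongr; linarith
      gcongr
      linarith
    have h2 := hΘ r hr hrε
    rw [sub_zero, energyDensity]
    calc _ ≤ |U r ^ 2 / 2| + |CV * Θ r| := abs_add_le _ _
      _ = U r ^ 2 / 2 + CV * |Θ r| := by
        rw [abs_mul, abs_of_pos hCV, abs_of_nonneg (by positivity)]
      _ ≤ (2 * ε) ^ 2 * (1 * M) / 2 + CV * M := by gcongr
      _ = _ := by ring
  have hn' : (1 : ℝ) ≤ n := by exact_mod_cast hn
  have hk1 : ((n : ℝ) - 1) / (n + 1) ≤ 1 := by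
    rw [div_le_one (by positivity)]; linarith
  have hS' : ∀ r, 0 < r → r ≤ 2 * ε → |deriv (heatPotential α κ μ₀ lam₀ P U Θ) r|
      ≤ 2 * ε * (C₁ * ((2 * (CV + 2 * ε ^ 2) + R) * M) + workConst n μ₀ lam₀ * (C * M)) := by
    intro r hr hrε
    have h1 := (h.exists_hasDerivAt_heatPotential hα0 hα1 hμ₀ hlam₀ hr (hP0 r hr hrε)
        (hP1 r hr hrε) (hV4 r hr hrε)).2
    have h2 := h.heatFlux_estimate hn hα0 hα1 hκ hR hμ₀ hlam₀ hP0 hP1 hV4 hΘ hE hr hrε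
    rw [mul_zero, zero_mul, add_zero] at h2
    have hUV : U r = U r / r * r := by field_simp
    have hV4' := abs_le.1 (hV4 r hr hrε)
    have hU : |U r| ≤ 1 / 4 * r := by
      rw [hUV, abs_mul, abs_of_pos hr]
      exact mul_le_mul_of_nonneg_right (hV4 r hr hrε) hr.le
    have hU' := abs_le.1 hU
    have hP := hP0 r hr hrε
    have hY0 : 0 < r / 2 + U r := by linarith
    have hY : (r / 2 + U r) * P r ≤ 2 * ε * C₁ := by
      have := hPC r hr hrε
      gcongr
      linarith
    have hY0' : 0 < (r / 2 + U r) * P r := mul_pos hY0 hP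
    have h3 : ((n : ℝ) - 1) / (n + 1) * ((CV + 2 * ε ^ 2) * M) * ((r / 2 + U r) * P r)
        ≤ 1 * ((CV + 2 * ε ^ 2) * M) * (2 * ε * C₁) := by gcongr
    have h4 : |(r / 2 + U r) * P r * energyDensity CV U Θ r|
        ≤ 2 * ε * C₁ * ((CV + 2 * ε ^ 2) * M) := by
      have := hE r hr hrε
      rw [sub_zero] at this
      rw [abs_mul, abs_of_pos hY0']
      gcongr
    have h5 : |R * (U r * P r * Θ r)| ≤ R * (2 * ε * C₁ * M) := by
      rw [abs_mul, abs_mul, abs_mul, abs_of_pos hR, abs_of_pos hP]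
      have := hPC r hr hrε
      have := hΘ r hr hrε
      gcongr
      linarith
    have h6 : workConst n μ₀ lam₀ * (r * (U r / r) ^ 2)
        ≤ workConst n μ₀ lam₀ * (2 * ε * (C * M)) := by
      have := hV2 r hr hrε
      gcongr
    rw [← workConst] at h1
    have h1' := abs_le.1 h1
    have h2' := abs_le.1 h2
    have h4' := abs_le.1 h4
    have h5' := abs_le.1 h5
    rw [abs_le]
    constructor <;> linarith
  have hmv := Convex.norm_image_sub_le_of_norm_hasDerivWithin_le
    (f := heatPotential α κ μ₀ lam₀ P U Θ) (s := Set.Ioc 0 (2 * ε))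
    (fun x hx => (h.exists_hasDerivAt_heatPotential hα0 hα1 hμ₀ hlam₀ hx.1 (hP0 x hx.1 hx.2)
        (hP1 x hx.1 hx.2) (hV4 x hx.1 hx.2)).1.hasDerivWithinAt)
    (fun x hx => hS' x hx.1 hx.2) (convex_Ioc _ _) (x := r) (y := r') ⟨hr, hrε⟩ ⟨hr', hrε'⟩
  rw [Real.norm_eq_abs, Real.norm_eq_abs] at hmv
  have hrr : |r' - r| ≤ 2 * ε := by rw [abs_le]; constructor <;> linarith
  have a1 := abs_le.1 (abs_heatPotential_sub_le (κ := κ) (Θ := Θ) hα0 hα1 hμ₀ hlam₀ hr hrε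
    (hP0 r hr hrε) (hP1 r hr hrε) (hV4 r hr hrε) (hV2 r hr hrε))
  have a2 := abs_le.1 (abs_heatPotential_sub_le (κ := κ) (Θ := Θ) hα0 hα1 hμ₀ hlam₀ hr' hrε'
    (hP0 r' hr' hrε') (hP1 r' hr' hrε') (hV4 r' hr' hrε') (hV2 r' hr' hrε'))
  have a3 := abs_le.1 (hmv.trans (mul_le_mul_of_nonneg_left hrr (by positivity)))
  have a4 : κ * |Θ r' - Θ r| ≤ κ * (M / (8 * (n + 1))) := by
    rw [← abs_of_pos hκ, ← abs_mul, abs_of_pos hκ]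
    have b1 := mul_le_mul_of_nonneg_right hsmall₁ hM0.le
    have b2 := mul_le_mul_of_nonneg_right hsmall₂ hM0.le
    have b3 : κ * (M / (8 * (n + 1))) = κ / (16 * (n + 1)) * M + κ / (16 * (n + 1)) * M := by
      field_simp; norm_num
    rw [b3, abs_le]
    constructor <;> linarith
  exact le_of_mul_le_mul_left a4 hκ

/-- Near the origin `|Θ|` stays away from an upper bound `M` valid on `(0, 2ε]`: otherwise `Θ` would
be nearly constant and of size `M`, and the heat flux it produces would push `|Θ|` above `M`. -/
theorem IsShrinkerProfile.abs_temperature_le_near_zero (hn : 1 ≤ n) (hα0 : 0 < α) (hα1 : α < 1)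
    (hCV : 0 < CV) (hκ : 0 < κ) (hR : 0 < R) (hμ₀ : 0 < μ₀) (hlam₀ : 0 < lam₀)
    (h : IsShrinkerProfile (n + 1) α CV κ R μ₀ lam₀ P U Θ) {ε C₁ C M Pε τ : ℝ}
    (hε : 0 < ε) (hC0 : 0 < C) (hC1 : C ≤ 1 / 2) (hM0 : 0 < M) (hMC : M ≤ C)
    (hP0 : ∀ r, 0 < r → r ≤ 2 * ε → 0 < P r) (hP1 : ∀ r, 0 < r → r ≤ 2 * ε → P r ≤ 1)
    (hPC : ∀ r, 0 < r → r ≤ 2 * ε → P r ≤ C₁) (hPε0 : 0 < Pε)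
    (hPε : ∀ r, ε ≤ r → Pε ≤ P r)
    (hV : ∀ r, 0 < r → r ≤ 2 * ε → |U r / r| ≤ C * M)
    (hΘ : ∀ r, 0 < r → r ≤ 2 * ε → |Θ r| ≤ M)
    (hsmall₁ : C₁ * (4 * ε ^ 2 * (2 * (CV + 2 * ε ^ 2) + R)) ≤ κ / (16 * (n + 1)))
    (hsmall₂ : C * (4 * ε ^ 2 * workConst n μ₀ lam₀ + 32 * (2 * μ₀ + lam₀) * ε ^ 2)
      ≤ κ / (16 * (n + 1)))
    (hsmall₃ : C * (4 * ε ^ 2 + 4 * R) ≤ CV / (2 * (n + 1)))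
    (hsmall₄ : C * (4 * ε ^ 2 * workConst n μ₀ lam₀ + 32 * (2 * μ₀ + lam₀) * ε ^ 2)
      ≤ ε ^ 2 * (CV * Pε / (8 * (n + 1))))
    (hτ₁ : τ ≤ 1 / (8 * (n + 1))) (hτ₂ : κ * τ ≤ ε ^ 2 * (CV * Pε / (16 * (n + 1))))
    {r₀ : ℝ} (hr₀ : 0 < r₀) (hrε₀ : r₀ ≤ ε) : |Θ r₀| ≤ (1 - τ) * M := by
  by_contra! hcon
  have hM1 : M ≤ 1 / 2 := hMC.trans hC1
  have hCM : C * M ≤ 1 / 4 := by nlinarith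
  have hV4 : ∀ r, 0 < r → r ≤ 2 * ε → |U r / r| ≤ 1 / 4 := fun r hr hrε => (hV r hr hrε).trans hCM
  have hV2 : ∀ r, 0 < r → r ≤ 2 * ε → (U r / r) ^ 2 ≤ C * M := fun r hr hrε => by
    rw [← sq_abs]
    nlinarith [abs_nonneg (U r / r), hV r hr hrε, hV4 r hr hrε]
  have hK0 : 0 ≤ workConst n μ₀ lam₀ := by unfold workConst; positivity
  have hn' : (1 : ℝ) ≤ n := by exact_mod_cast hn
  set k : ℝ := ((n : ℝ) - 1) / (n + 1) with hk
  have hk0 : 0 ≤ k := div_nonneg (by linarith) (by linarith)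
  have hk1 : k ≤ 1 := by rw [hk, div_le_one (by positivity)]; linarith
  -- Since `k < 1`, the energy transported by the mass flux is not balanced by `k c` times it; this
  -- surplus drives the heat flux outward in the direction of growing `|Θ|`.
  have hk2 : CV * (1 - k) = 2 * (CV / (n + 1)) := by rw [hk]; field_simp; ring
  obtain ⟨s, hs, hsΘ⟩ : ∃ s : ℝ, |s| = 1 ∧ s * Θ r₀ = |Θ r₀| := by
    rcases le_total 0 (Θ r₀) with h0 | h0
    · exact ⟨1, by norm_num, by rw [one_mul, abs_of_nonneg h0]⟩
    · exact ⟨-1, by norm_num, by rw [abs_of_nonpos h0]; ring⟩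
  have hss : s * s = 1 := by rw [← abs_mul_abs_self, hs, one_mul]
  have hsa : ∀ x, |s * x| = |x| := fun x => by rw [abs_mul, hs, one_mul]
  have hε2 : ε ≤ 2 * ε := by linarith
  have hr₀2 : r₀ ≤ 2 * ε := hrε₀.trans hε2
  have hclose : ∀ r, 0 < r → r ≤ 2 * ε → |Θ r - s * M| ≤ M / (4 * (n + 1)) := by
    intro r hr hrε
    have h1 := h.oscillation_le hn hα0 hα1 hCV hκ hR hμ₀ hlam₀ hε hC0 hC1 hM0 hMC hP0 hP1 hPC hV
      hΘ hsmall₁ hsmall₂ hr₀ hr₀2 hr hrε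
    have h2 : |Θ r₀ - s * M| ≤ τ * M := by
      rw [← hsa, show s * (Θ r₀ - s * M) = s * Θ r₀ - s * s * M by ring, hss, hsΘ, abs_le]
      have := hΘ r₀ hr₀ hr₀2
      constructor <;> linarith
    have h3 : τ * M ≤ 1 / (8 * (n + 1)) * M := by gcongr
    have h4 : M / (4 * (n + 1)) = M / (8 * (n + 1)) + 1 / (8 * (n + 1)) * M := by
      field_simp; norm_num
    calc |Θ r - s * M| = |(Θ r - Θ r₀) + (Θ r₀ - s * M)| := by ring_nf
      _ ≤ |Θ r - Θ r₀| + |Θ r₀ - s * M| := abs_add_le _ _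
      _ ≤ _ := by linarith
  set e := CV * (M / (4 * (n + 1))) + 2 * ε ^ 2 * (C * M) with he
  have hE : ∀ r, 0 < r → r ≤ 2 * ε → |energyDensity CV U Θ r - CV * (s * M)| ≤ e := by
    intro r hr hrε
    have hUV : U r ^ 2 = r ^ 2 * (U r / r) ^ 2 := by field_simp
    have h1 : U r ^ 2 ≤ (2 * ε) ^ 2 * (C * M) := by
      rw [hUV]
      have := hV2 r hr hrε
      gcongr
    have h2 := hclose r hr hrε
    calc _ = |U r ^ 2 / 2 + CV * (Θ r - s * M)| := by rw [energyDensity]; ring_nf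
      _ ≤ |U r ^ 2 / 2| + |CV * (Θ r - s * M)| := abs_add_le _ _
      _ = U r ^ 2 / 2 + CV * |Θ r - s * M| := by
        rw [abs_mul, abs_of_pos hCV, abs_of_nonneg (by positivity)]
      _ ≤ (2 * ε) ^ 2 * (C * M) / 2 + CV * (M / (4 * (n + 1))) := by gcongr
      _ = _ := by rw [he]; ring
  have hSd : ∀ r, 0 < r → r ≤ 2 * ε → HasDerivAt (heatPotential α κ μ₀ lam₀ P U Θ)
      (deriv (heatPotential α κ μ₀ lam₀ P U Θ) r) r := fun r hr hrε =>
    (h.exists_hasDerivAt_heatPotential hα0 hα1 hμ₀ hlam₀ hr (hP0 r hr hrε)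
        (hP1 r hr hrε) (hV4 r hr hrε)).1
  have hS' : ∀ r, 0 < r → r ≤ 2 * ε → r / 4 * P r * (M * (CV / (n + 1)))
      - workConst n μ₀ lam₀ * (2 * ε * (C * M))
        ≤ s * deriv (heatPotential α κ μ₀ lam₀ P U Θ) r := by
    intro r hr hrε
    have h1 := (h.exists_hasDerivAt_heatPotential hα0 hα1 hμ₀ hlam₀ hr (hP0 r hr hrε)
        (hP1 r hr hrε) (hV4 r hr hrε)).2
    rw [← workConst, ← hsa] at h1
    have h2 := h.heatFlux_estimate hn hα0 hα1 hκ hR hμ₀ hlam₀ hP0 hP1 hV4 hΘ hE hr hrε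
    rw [← hk, ← hsa] at h2
    have hUV : U r = U r / r * r := by field_simp
    have hU : |U r| ≤ C * M * r := by
      rw [hUV, abs_mul, abs_of_pos hr]
      exact mul_le_mul_of_nonneg_right (hV r hr hrε) hr.le
    have hU' := abs_le.1 hU
    have hP := hP0 r hr hrε
    have hCMr : C * M * r ≤ 1 / 4 * r := by gcongr
    have hY4 : r / 4 ≤ r / 2 + U r := by linarith
    have hY0 : 0 < (r / 2 + U r) * P r := mul_pos (by linarith) hP
    set Y := (r / 2 + U r) * P r with hYdef
    have h3 : |R * (U r * P r * Θ r)| ≤ Y * (4 * R * (C * M)) := by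
      rw [abs_mul, abs_mul, abs_mul, abs_of_pos hR, abs_of_pos hP]
      have a1 := hΘ r hr hrε
      have a2 : |U r| ≤ C * M * (4 * (r / 2 + U r)) := hU.trans (by gcongr; linarith)
      calc R * (|U r| * P r * |Θ r|) ≤ R * (C * M * (4 * (r / 2 + U r)) * P r * 1) := by
            have hM1' : |Θ r| ≤ 1 := a1.trans (by linarith)
            have : 0 ≤ C * M * (4 * (r / 2 + U r)) := (abs_nonneg _).trans a2
            gcongr
        _ = Y * (4 * R * (C * M)) := by rw [hYdef]; ring
    rw [← hsa] at h3
    have h4 := hE r hr hrε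
    rw [← hsa] at h4
    have h6 : workConst n μ₀ lam₀ * (r * (U r / r) ^ 2)
        ≤ workConst n μ₀ lam₀ * (2 * ε * (C * M)) := by
      have := hV2 r hr hrε
      gcongr
    have h7 : k * e * Y ≤ 1 * e * Y := by
      have he0 : 0 ≤ e := by positivity
      gcongr
    have h8 : r / 4 * P r * (M * (CV / (n + 1))) ≤ Y * (M * (CV / (n + 1))) := by
      rw [hYdef]; gcongr
    have h9 : Y * (CV * M - e) ≤ Y * (s * energyDensity CV U Θ r) := by
      gcongr
      have := (abs_le.1 h4).1
      have e1 : s * (energyDensity CV U Θ r - CV * (s * M))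
        = s * energyDensity CV U Θ r - CV * M := by linear_combination (-CV * M) * hss
      linarith
    have h10 : Y * (M * (CV / (n + 1)))
        -- Of the surplus `2 CV M/(n+1)`, a quarter pays for the oscillation of `Θ` and a quarter,
        -- by `hsmall₃`, for kinetic energy and pressure work; half remains.
        ≤ Y * (CV * M * (1 - k) - 2 * e - 4 * R * (C * M)) := by
      gcongr
      have b1 := mul_le_mul_of_nonneg_right hsmall₃ hM0.le
      have b2 : CV * M * (1 - k) = 2 * (M * (CV / (n + 1))) := by linear_combination M * hk2
      have b3 : 2 * (CV * (M / (4 * (n + 1)))) = M * (CV / (n + 1)) / 2 := by field_simp; norm_num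
      have b4 : CV / (2 * (n + 1)) * M = M * (CV / (n + 1)) / 2 := by field_simp
      rw [b2, he]
      linarith
    have h1' := (abs_le.1 h1).1
    have h2' := (abs_le.1 h2).1
    have h3' := (abs_le.1 h3).1
    have e2 : s * (heatFlux n α κ μ₀ lam₀ P U Θ r - Y * energyDensity CV U Θ r
        - R * (U r * P r * Θ r) + k * (CV * (s * M)) * Y)
        = s * heatFlux n α κ μ₀ lam₀ P U Θ r - Y * (s * energyDensity CV U Θ r)
        - s * (R * (U r * P r * Θ r)) + k * CV * M * Y := by
      linear_combination (k * CV * M * Y) * hss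
    rw [e2] at h2'
    linarith
  have hderiv : ∀ r, 0 < r → r ≤ 2 * ε → HasDerivAt
      (fun r => s * heatPotential α κ μ₀ lam₀ P U Θ r)
      (s * deriv (heatPotential α κ μ₀ lam₀ P U Θ) r) r := fun r hr hrε =>
    (hSd r hr hrε).const_mul s
  have hmv : ∀ a b D, 0 < a → a ≤ b → b ≤ 2 * ε →
      (∀ r, a ≤ r → r ≤ b → D ≤ s * deriv (heatPotential α κ μ₀ lam₀ P U Θ) r) →
      D * (b - a) ≤ s * heatPotential α κ μ₀ lam₀ P U Θ b
        - s * heatPotential α κ μ₀ lam₀ P U Θ a := by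
    intro a b D ha hab hb hD
    refine (convex_Icc a b).mul_sub_le_image_sub_of_le_deriv
      (f := fun r => s * heatPotential α κ μ₀ lam₀ P U Θ r)
      (fun x hx => (hderiv x (ha.trans_le hx.1)
        (hx.2.trans hb)).continuousAt.continuousWithinAt)
      (fun x hx => ?_) (fun x hx => ?_) a (Set.left_mem_Icc.2 hab) b (Set.right_mem_Icc.2 hab) hab
    · have hx := interior_subset hx
      exact (hderiv x (ha.trans_le hx.1) (hx.2.trans hb)).differentiableAt.differentiableWithinAt
    · have hx := interior_subset hx
      rw [(hderiv x (ha.trans_le hx.1) (hx.2.trans hb)).deriv]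
      exact hD x hx.1 hx.2
  set W := workConst n μ₀ lam₀ * (2 * ε * (C * M)) with hW
  have hW0 : 0 ≤ W := by positivity
  -- Inside `ε` the density has no quantitative lower bound, so only the sign of the main term is
  -- used; the gain comes from `[ε, 2ε]`.
  have m1 := hmv r₀ ε (-W) hr₀ hrε₀ hε2 (fun r h1 h2 => by
    have hr := hr₀.trans_le h1
    have := hS' r hr (h2.trans hε2)
    have hP := hP0 r hr (h2.trans hε2)
    have : 0 ≤ r / 4 * P r * (M * (CV / (n + 1))) := by positivity
    linarith)
  have m2 := hmv ε (2 * ε) (ε / 4 * Pε * (M * (CV / (n + 1))) - W) hε hε2 le_rfl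
    (fun r h1 h2 => by
      have hr := hε.trans_le h1
      have := hS' r hr h2
      have hP := hPε r h1
      have : ε / 4 * Pε * (M * (CV / (n + 1))) ≤ r / 4 * P r * (M * (CV / (n + 1))) := by gcongr
      linarith)
  have a1 := abs_heatPotential_sub_le (κ := κ) (Θ := Θ) hα0 hα1 hμ₀ hlam₀ hr₀ hr₀2
    (hP0 r₀ hr₀ hr₀2) (hP1 r₀ hr₀ hr₀2) (hV4 r₀ hr₀ hr₀2) (hV2 r₀ hr₀ hr₀2)
  have h2ε : 0 < 2 * ε := by linarith
  have a2 := abs_heatPotential_sub_le (κ := κ) (Θ := Θ) hα0 hα1 hμ₀ hlam₀ h2ε le_rfl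
    (hP0 _ h2ε le_rfl) (hP1 _ h2ε le_rfl) (hV4 _ h2ε le_rfl) (hV2 _ h2ε le_rfl)
  rw [← hsa] at a1 a2
  have a1' := (abs_le.1 a1).1
  have a2' := (abs_le.1 a2).2
  have a3 : s * Θ (2 * ε) ≤ M := (le_abs_self _).trans ((hsa _).le.trans (hΘ _ h2ε le_rfl))
  have a4 : κ * (s * Θ (2 * ε)) ≤ κ * M := by gcongr
  have a5 : κ * ((1 - τ) * M) < κ * (s * Θ r₀) := by rw [hsΘ]; gcongr
  have a6 := mul_le_mul_of_nonneg_right hτ₂ hM0.le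
  have a7 := mul_le_mul_of_nonneg_right hsmall₄ hM0.le
  have a8 : W * (ε - r₀) ≤ W * ε := by gcongr; linarith
  have a9 : 0 < ε ^ 2 * (CV * Pε / (n + 1)) * M := by positivity
  have e1 : ε / 4 * Pε * (M * (CV / (n + 1))) * ε = ε ^ 2 * (CV * Pε / (n + 1)) * M / 4 := by ring
  have e2 : ε ^ 2 * (CV * Pε / (16 * (n + 1))) * M = ε ^ 2 * (CV * Pε / (n + 1)) * M / 16 := by
    field_simp
  have e3 : ε ^ 2 * (CV * Pε / (8 * (n + 1))) * M = ε ^ 2 * (CV * Pε / (n + 1)) * M / 8 := by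
    field_simp
  rw [hW] at a8 m1 m2
  -- With `G = ε² CV Pε M/(n+1)`, the gain is `G/4`, the errors in velocity cost at most `G/8`, and
  -- the room `κτM` below the bound is at most `G/16`.
  linarith

/-! ### Conclusion -/

theorem IsShrinkerProfile.temperature_eq_zero (hn : 1 ≤ n) (hα0 : 0 < α) (hα1 : α < 1)
    (hCV : 0 < CV) (hκ : 0 < κ) (hR : 0 < R) (hμ₀ : 0 < μ₀) (hlam₀ : 0 < lam₀)
    (h : IsShrinkerProfile (n + 1) α CV κ R μ₀ lam₀ P U Θ) {ε C₁ C Pε : ℝ}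
    (hε : 0 < ε) (hC0 : 0 < C) (hC1 : C ≤ 1 / 2)
    (hP0 : ∀ r, 0 < r → 0 < P r) (hP1 : ∀ r, 0 < r → P r ≤ 1)
    (hPC : ∀ r, 0 < r → P r ≤ C₁) (hPε0 : 0 < Pε) (hPε : ∀ r, ε ≤ r → Pε ≤ P r)
    (hΘ : ∀ r, 0 < r → (1 + r ^ 2) * |Θ r| ≤ C) (hU : ∀ r, 0 < r → |U r| ≤ C * |r * Θ r|)
    (hU' : ∀ r, ε < r → |deriv U r| ≤ C * |r * deriv Θ r|)
    (hsmall₁ : C₁ * (4 * ε ^ 2 * (2 * (CV + 2 * ε ^ 2) + R)) ≤ κ / (16 * (n + 1)))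
    (hsmall₂ : C * (4 * ε ^ 2 * workConst n μ₀ lam₀ + 32 * (2 * μ₀ + lam₀) * ε ^ 2)
      ≤ κ / (16 * (n + 1)))
    (hsmall₃ : C * (4 * ε ^ 2 + 4 * R) ≤ CV / (2 * (n + 1)))
    (hsmall₄ : C * (4 * ε ^ 2 * workConst n μ₀ lam₀ + 32 * (2 * μ₀ + lam₀) * ε ^ 2)
      ≤ ε ^ 2 * (CV * Pε / (8 * (n + 1))))
    (hsmall₅ : C * (R * n + Pε ^ (α - 1) * (2 * μ₀ * n + lam₀ * n ^ 2)) < CV)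
    {r : ℝ} (hr : 0 < r) : Θ r = 0 := by
  have hΘC : ∀ r, 0 < r → |Θ r| ≤ C := fun r hr =>
    le_trans (by nlinarith [abs_nonneg (Θ r), sq_nonneg r]) (hΘ r hr)
  set A : Set ℝ := (fun r => |Θ r|) '' Set.Ioi 0 with hA
  have hAne : A.Nonempty := ⟨_, 1, Set.mem_Ioi.2 one_pos, rfl⟩
  have hAb : BddAbove A := ⟨C, by rintro _ ⟨r, hr, rfl⟩; exact hΘC r hr⟩
  set M := sSup A with hM
  have hMle : ∀ r, 0 < r → |Θ r| ≤ M := fun r hr => le_csSup hAb ⟨r, hr, rfl⟩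
  have hMC : M ≤ C := csSup_le hAne (by rintro _ ⟨r, hr, rfl⟩; exact hΘC r hr)
  by_contra hne
  have hM0 : 0 < M := (abs_pos.2 hne).trans_le (hMle r hr)
  have hV : ∀ r, 0 < r → |U r / r| ≤ C * M := fun r hr => by
    rw [abs_div, abs_of_pos hr, div_le_iff₀ hr]
    calc |U r| ≤ C * |r * Θ r| := hU r hr
      _ = C * |Θ r| * r := by rw [abs_mul, abs_of_pos hr]; ring
      _ ≤ _ := by gcongr; exact hMle r hr
  set τ := min (1 / (8 * ((n : ℝ) + 1))) (ε ^ 2 * (CV * Pε / (16 * (n + 1))) / κ) with hτ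
  have hτ0 : 0 < τ := by positivity
  have hnear : ∀ r, 0 < r → r ≤ ε → |Θ r| ≤ (1 - τ) * M := fun r hr hrε =>
    h.abs_temperature_le_near_zero hn hα0 hα1 hCV hκ hR hμ₀ hlam₀ hε hC0 hC1 hM0 hMC
      (fun r hr _ => hP0 r hr) (fun r hr _ => hP1 r hr) (fun r hr _ => hPC r hr) hPε0 hPε
      (fun r hr _ => hV r hr) (fun r hr _ => hMle r hr) hsmall₁ hsmall₂ hsmall₃ hsmall₄
      (min_le_left _ _) (by rw [mul_comm, ← le_div_iff₀ hκ]; exact min_le_right _ _) hr hrε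
  -- Beyond `2C/M` the decay bound and `1 + r² ≥ 2r` give `|Θ| ≤ M/2`.
  set r₁ := ε + 2 * C / M with hr₁
  have hεr₁ : ε ≤ r₁ := le_add_of_nonneg_right (by positivity)
  have hfar : ∀ r, r₁ ≤ r → |Θ r| ≤ M / 2 := by
    intro r hr
    have h0 : 0 < r := hε.trans_le (hεr₁.trans hr)
    have h1 : 2 * C / M ≤ r := by linarith
    rw [div_le_iff₀ hM0] at h1
    have h2 : 0 < 1 + r ^ 2 := by positivity
    refine le_of_mul_le_mul_left ((hΘ r h0).trans ?_) h2
    nlinarith [sq_nonneg (r - 1)]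
  have hcont : ContinuousOn (fun r => |Θ r|) (Set.Icc ε r₁) :=
    (h.contDiffOn_Θ.continuousOn.mono fun x hx => hε.trans_le hx.1).abs
  obtain ⟨x, hx, hxmax⟩ := isCompact_Icc.exists_isMaxOn ⟨ε, Set.left_mem_Icc.2 hεr₁⟩ hcont
  have hx0 : 0 < x := hε.trans_le hx.1
  have hxM : |Θ x| = M := by
    refine le_antisymm (hMle x hx0) ?_
    by_contra! hlt
    have : M ≤ max |Θ x| (max ((1 - τ) * M) (M / 2)) := by
      refine csSup_le hAne ?_
      rintro _ ⟨r, hr, rfl⟩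
      rcases le_total r ε with h1 | h1
      · exact (hnear r hr h1).trans ((le_max_left _ _).trans (le_max_right _ _))
      rcases le_total r r₁ with h2 | h2
      · exact (hxmax ⟨h1, h2⟩).trans (le_max_left _ _)
      · exact (hfar r h2).trans ((le_max_right _ _).trans (le_max_right _ _))
    refine absurd this (not_le.2 (max_lt hlt (max_lt ?_ (by linarith))))
    nlinarith
  -- Strictness matters: `U'` is controlled by `Θ'` only for `r > ε`, while the bound near the
  -- origin includes `r = ε`.
  have hεx : ε < x := by
    refine lt_of_le_of_ne hx.1 ?_
    rintro rfl
    have := hnear ε hε le_rfl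
    rw [hxM] at this
    nlinarith
  exact h.not_isMax hκ hR hμ₀ hlam₀ hx0 hC0 (by linarith) hMC hPε0 (hPε x hx.1) hα1 hsmall₅
    (hU x hx0) (hU' x hεx) hM0 hxM hMle

end ODE

end CNSShrinker

end

theorem mainTheorem3 (d : ℕ) (hd : 3 ≤ d) (α : ℝ) (hα0 : 0 < α) (hα1 : α < 1)
    (CV κ R μ₀ lam₀ : ℝ) (hCV : 0 < CV) (hκ : 0 < κ) (hR : 0 < R) (hμ₀ : 0 < μ₀)
    (hlam₀ : 0 < lam₀) (hCVκ : CV ≤ κ / (2 * μ₀ + lam₀))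
    (ε Λ : ℝ) (hε : 0 < ε) (hΛ : 0 < Λ) :
    ∃ C₁ : ℝ, 0 < C₁ ∧ ∀ Pε : ℝ, 0 < Pε → ∃ C₂ : ℝ, 0 < C₂ ∧
      ∀ P U Θ : ℝ → ℝ,
        CNSShrinker.IsShrinkerProfile d α CV κ R μ₀ lam₀ P U Θ →
        CNSShrinker.Cavitates α ε Pε Λ P →
        CNSShrinker.densitySize α P < ENNReal.ofReal C₁ →
        CNSShrinker.profileSize ε U Θ < ENNReal.ofReal C₂ →
        (∀ r : ℝ, 0 < r → U r = 0) ∧ (∀ r : ℝ, 0 < r → Θ r = 0) ∧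
          ∃ c : ℝ, ∀ r : ℝ, 0 < r → P r = c := by
  obtain ⟨n, rfl⟩ : ∃ n, d = n + 1 := ⟨d - 1, by omega⟩
  have hn : 1 ≤ n := by omega
  have hsmall : ∀ a b : ℝ, 0 < b → ∀ᶠ C in nhdsWithin (0 : ℝ) (Set.Ioi 0), C * a < b := by
    intro a b hb
    have h1 : Filter.Tendsto (fun C : ℝ => C * a) (nhdsWithin 0 (Set.Ioi 0)) (nhds (0 * a)) :=
      (Filter.tendsto_id.mul_const a).mono_left nhdsWithin_le_nhds
    rw [zero_mul] at h1
    exact h1.eventually (gt_mem_nhds hb)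
  have hpos : ∀ᶠ C in nhdsWithin (0 : ℝ) (Set.Ioi 0), 0 < C := self_mem_nhdsWithin
  -- Small density serves only to make `Θ` nearly constant on `(0, 2ε]`, so `C₁` is fixed before
  -- `Pε`.
  obtain ⟨C₁, ⟨hC₁, hC₁1⟩, hsmall₁⟩ := ((hpos.and (hsmall 1 1 one_pos)).and
    (hsmall (4 * ε ^ 2 * (2 * (CV + 2 * ε ^ 2) + R)) (κ / (16 * (n + 1)))
      (by positivity))).exists
  refine ⟨C₁, hC₁, fun Pε hPε => ?_⟩
  obtain ⟨C, ⟨⟨⟨⟨hC0, hC1⟩, hsmall₂⟩, hsmall₃⟩, hsmall₄⟩, hsmall₅⟩ :=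
    (((((hpos.and (hsmall 1 (1 / 2) (by norm_num))).and
      (hsmall (4 * ε ^ 2 * CNSShrinker.workConst n μ₀ lam₀ + 32 * (2 * μ₀ + lam₀) * ε ^ 2)
        (κ / (16 * (n + 1))) (by positivity))).and
      (hsmall (4 * ε ^ 2 + 4 * R) (CV / (2 * (n + 1))) (by positivity))).and
      (hsmall (4 * ε ^ 2 * CNSShrinker.workConst n μ₀ lam₀ + 32 * (2 * μ₀ + lam₀) * ε ^ 2)
        (ε ^ 2 * (CV * Pε / (8 * (n + 1)))) (by positivity))).and
      (hsmall (R * n + Pε ^ (α - 1) * (2 * μ₀ * n + lam₀ * n ^ 2)) CV hCV)).exists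
  refine ⟨C, hC0, fun P U Θ h hcav hden hprof => ?_⟩
  obtain ⟨hΘ, hU, hU'⟩ := CNSShrinker.bounds_of_profileSize_lt hC0.le hprof
  have hP0 : ∀ r, 0 < r → 0 < P r := fun r hr => by
    rcases lt_or_ge r ε with h1 | h1
    · exact hcav.pos r hr h1
    · exact hPε.trans_le (hcav.lower_bound r h1)
  have hα : 0 < 1 - α := by linarith
  have hP1 : ∀ r, 0 < r → P r ≤ 1 := fun r hr => by
    by_contra! h1
    have h2 := CNSShrinker.rpow_lt_of_densitySize_lt hden hr
    have h3 := Real.one_le_rpow h1.le hα.le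
    linarith
  -- For `P ≤ 1` the exponent `1 - α < 1` only increases the value, so the bound on `P^{1-α}` passes
  -- to `P`.
  have hPC : ∀ r, 0 < r → P r ≤ C₁ := fun r hr => by
    calc P r = P r ^ (1 : ℝ) := (Real.rpow_one _).symm
      _ ≤ P r ^ (1 - α) :=
        Real.rpow_le_rpow_of_exponent_ge (hP0 r hr) (hP1 r hr) (by linarith)
      _ ≤ C₁ := (CNSShrinker.rpow_lt_of_densitySize_lt hden hr).le
  have hΘ0 : ∀ r : ℝ, 0 < r → Θ r = 0 := fun r hr =>
    h.temperature_eq_zero hn hα0 hα1 hCV hκ hR hμ₀ hlam₀ hε hC0 (by linarith) hP0 hP1 hPC hPε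
      hcav.lower_bound hΘ hU hU' hsmall₁.le hsmall₂.le hsmall₃.le hsmall₄.le hsmall₅ hr
  have hU0 : ∀ r : ℝ, 0 < r → U r = 0 := fun r hr => by
    have := hU r hr
    rw [hΘ0 r hr, mul_zero, abs_zero, mul_zero] at this
    exact abs_nonpos_iff.1 this
  refine ⟨hU0, hΘ0, ?_⟩
  refine isOpen_Ioi.exists_is_const_of_deriv_eq_zero isPreconnected_Ioi
    (h.contDiffOn_P.differentiableOn (by norm_num)) (fun r hr => ?_)
  have hr : 0 < r := hr
  have hUd : deriv U r = 0 := by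
    have : U =ᶠ[nhds r] fun _ => 0 := by
      filter_upwards [Ioi_mem_nhds hr] with x hx using hU0 x hx
    rw [this.deriv_eq, deriv_const]
  have hm := h.mass r hr
  rw [hUd, hU0 r hr] at hm
  have : r * deriv P r = 0 := by linear_combination 2 * hm
  exact (mul_eq_zero.1 this).resolve_left hr.ne'
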